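/- **Theorem (each symplectic Lie $n$-algebroid comes with an associated Lie $n$-algebra).** Let $\mathcal M$ be an $\mathbb N$-graded manifold with body the smooth manifold $M$, i.e. a sheaf of $\mathbb N$-graded, graded-commutative real algebras on $M$ whose degree-$0$ part is the sheaf of smooth functions on $M$ and which is locally freely generated over it by finitely many generators of prescribed positive degrees. Write $\mathcal C^\infty(\mathcal M)=\mathcal A_0\oplus\mathcal A_1\oplus\cdots$ for the decomposition of the global functions by degree, so $\mathcal A_0=\mathcal C^\infty(M)$. Let $n\ge 0$ and let $(\mathcal M,\{-,-\},\Theta)$ be a symplectic Lie $n$-algebroid: $\{-,-\}$ is a Poisson bracket of degree $-n$ on the functions on $\mathcal M$, that is, for homogeneous $a,b,c$, $$\{a,b\}=-(-1)^{(|a|+n)(|b|+n)}\{b,a\},\qquad \{a,bc\}=\{a,b\}c+(-1)^{(|a|+n)|b|}b\{a,c\},$$ $$\{a,\{b,c\}\}=\{\{a,b\},c\}+(-1)^{(|a|+n)(|b|+n)}\{b,\{a,c\}\},$$ which is non-degenerate (in all local coordinates $z$ the matrix $\{z^i,z^j\}$ is invertible), and $\Theta\in\mathcal A_{n+1}$ satisfies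 $\{\Theta,\Theta\}=0$. Let $\mathsf L=\mathcal A_0\oplus\mathcal A_1\oplus\cdots\oplus\mathcal A_{n-1}$ with $\mathcal A_i$ placed in degree $i+1-n$, so that $\mathsf L$ is concentrated in degrees $1-n,\dots,0$; below, $|e|$ denotes this degree. Put $\delta e=\{\Theta,e\}$ for $e\in\mathcal A_{n-1}$ and $\delta e=0$ for $e\in\mathcal A_i$, $i<n-1$. Then there are multilinear maps $\mu_k:\mathsf L^k\to\mathsf L$, $k\ge1$, such that $$\mu_1(e)=\begin{cases}0,& e\in\mathcal A_{n-1},\\ \{\Theta,e\},& e\in\mathcal A_i,\ i<n-1,\end{cases}$$ and, for $k\ge2$ and homogeneous $e_1,\dots,e_k\in\mathsf L$, $$\mu_k(e_1,\dots,e_k)=-\frac{B_{k-1}}{(k-1)!}\sum_{\sigma\in S_k}(-1)^\sigma\{\dots\{\{\delta e_{\sigma(1)},e_{\sigma(2)}\},e_{\sigma(3)}\}\dots,e_{\sigma(k)}\},$$ where $B_0,B_1,B_2,\ldots=1,-\tfrac12,\tfrac16,\ldots$ are the Bernoulli numbers and $(-1)^\sigma=(-1)^{\sum_i(k-i)|e_i|}\,\varepsilon(\sigma)$,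 with $\varepsilon(\sigma)$ the Koszul sign of permuting graded commuting elements of degrees $|e_1|-1,\dots,|e_k|-1$ into the order $\sigma(1),\dots,\sigma(k)$ (so $(-1)^\sigma$ is the signature of $\sigma$ if all $e_i\in\mathcal A_{n-1}$); and these maps make $\mathsf L$ an $n$-term $L_\infty$-algebra. That is, $\mu_k$ is graded antisymmetric of degree $2-k$, and for all $m\ge1$ and homogeneous $e_1,\dots,e_m\in\mathsf L$ $$\sum_{i=1}^m\ \sum_{\sigma}(-1)^{i(m-i)}\chi(\sigma)\,\mu_{m-i+1}\big(\mu_i(e_{\sigma(1)},\dots,e_{\sigma(i)}),e_{\sigma(i+1)},\dots,e_{\sigma(m)}\big)=0,$$ where $\sigma$ runs over the $(i,m-i)$-unshuffles and $\chi(\sigma)$ is the signature of $\sigma$ times its Koszul sign for the degrees $|e_1|,\dots,|e_m|$. -/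

import Mathlib

open TopologicalSpace
open scoped Manifold ContDiff

universe u v

/-! ### Graded manifolds -/

/-- The monomial exponents in generators of degrees `deg`: odd generators occur at most once. -/
def FibreExponent {r : ℕ} (deg : Fin r → ℕ) : Type :=
  {α : Fin r → ℕ // ∀ a, Odd (deg a) → α a ≤ 1}

/-- The ordered monomial `ξ_1 ^ α_1 ⋯ ξ_r ^ α_r` in a (not necessarily commutative) ring. -/
def fibreMonomial {R : Type*} [Ring R] {r : ℕ} {deg : Fin r → ℕ} (ξ : Fin r → R)
    (α : FibreExponent deg) : R :=
  (List.ofFn fun a => ξ a ^ α.1 a).prod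

/-- An `ℕ`-graded manifold with body the `d`-dimensional smooth manifold `M`: a sheaf
`U ↦ O U = ⨁ i, gr U i` of `ℕ`-graded, graded-commutative real algebras on `M` whose part of
degree `0` is the sheaf of smooth functions on `M`, and which is locally freely generated over
the smooth functions by finitely many generators of positive degree. -/
structure GradedManifold (d : ℕ) (M : Type u) [TopologicalSpace M]
    [ChartedSpace (EuclideanSpace ℝ (Fin d)) M] [IsManifold (𝓡 d) ∞ M] where
  /-- the algebra of functions over an open subset of the body -/
  O : Opens M → Type v
  [ring : ∀ U, Ring (O U)]
  [algebra : ∀ U, Algebra ℝ (O U)]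
  /-- functions that are homogeneous of a given degree -/
  gr : ∀ U, ℕ → Submodule ℝ (O U)
  gradedMonoid : ∀ U, SetLike.GradedMonoid (gr U)
  isInternal : ∀ U, DirectSum.IsInternal (gr U)
  graded_comm : ∀ (U : Opens M) (i j : ℕ) (a b : O U), a ∈ gr U i → b ∈ gr U j →
    a * b = (-1 : ℝ) ^ (i * j) • (b * a)
  /-- restriction to a smaller open subset -/
  res : ∀ {U V : Opens M}, V ≤ U → O U →ₐ[ℝ] O V
  res_mem : ∀ {U V : Opens M} (h : V ≤ U) (i : ℕ) (a : O U), a ∈ gr U i → res h a ∈ gr V i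
  res_self : ∀ (U : Opens M) (a : O U), res (le_refl U) a = a
  res_res : ∀ {U V W : Opens M} (h : V ≤ U) (h' : W ≤ V) (a : O U),
    res h' (res h a) = res (h'.trans h) a
  /-- the sheaf condition, in each degree -/
  glue : ∀ (ι : Type u) (U : ι → Opens M) (k : ℕ) (s : ∀ i, O (U i)),
    (∀ i, s i ∈ gr (U i) k) →
    (∀ i j, res (inf_le_left : U i ⊓ U j ≤ U i) (s i) =
      res (inf_le_right : U i ⊓ U j ≤ U j) (s j)) →
    ∃! t : O (⨆ i, U i), t ∈ gr (⨆ i, U i) k ∧ ∀ i, res (le_iSup U i) t = s i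
  /-- the inclusion of the smooth functions on the body -/
  fn : ∀ U : Opens M, C^∞⟮𝓡 d, U; 𝓘(ℝ, ℝ), ℝ⟯ →ₐ[ℝ] O U
  fn_injective : ∀ U, Function.Injective (fn U)
  fn_range : ∀ (U : Opens M) (a : O U), a ∈ gr U 0 ↔ ∃ f, fn U f = a
  fn_res : ∀ {U V : Opens M} (h : V ≤ U) (f : C^∞⟮𝓡 d, U; 𝓘(ℝ, ℝ), ℝ⟯),
    res h (fn U f) = fn V (ContMDiffMap.restrictRingHom (𝓡 d) 𝓘(ℝ, ℝ) ℝ h f)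
  /-- the number of generators -/
  rank : ℕ
  /-- the degrees of the generators -/
  deg : Fin rank → ℕ
  deg_pos : ∀ a, 0 < deg a
  /-- Around every point there are homogeneous generators `ξ` of the prescribed degrees such that
  every function is, over each smaller open subset `V`, a unique finite linear combination of
  monomials in `ξ` with coefficients smooth functions on `V`. -/
  locally_free : ∀ x : M, ∃ (U : Opens M) (ξ : Fin rank → O U), x ∈ U ∧
    (∀ a, ξ a ∈ gr U (deg a)) ∧
    ∀ (V : Opens M) (h : V ≤ U) (f : O V),
      ∃! c : FibreExponent deg →₀ C^∞⟮𝓡 d, V; 𝓘(ℝ, ℝ), ℝ⟯,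
        f = c.sum fun α g => fn V g * fibreMonomial (fun a => res h (ξ a)) α

attribute [instance] GradedManifold.ring GradedManifold.algebra

namespace GradedManifold

variable {d : ℕ} {M : Type u} [TopologicalSpace M]
  [ChartedSpace (EuclideanSpace ℝ (Fin d)) M] [IsManifold (𝓡 d) ∞ M]

/-- `(x, ξ)` is a system of local coordinates of the graded manifold over `U`: the `x i` are the
components of a smooth chart of the body with domain `U`, and the `ξ a` are homogeneous free
generators over `U`. -/
structure IsCoordinates (𝓜 : GradedManifold.{u, v} d M) (U : Opens M)
    (x : Fin d → C^∞⟮𝓡 d, U; 𝓘(ℝ, ℝ), ℝ⟯) (ξ : Fin 𝓜.rank → 𝓜.O U) : Prop where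
  chart : ∃ e ∈ IsManifold.maximalAtlas (𝓡 d) ∞ M, e.source = (U : Set M) ∧
    ∀ (i : Fin d) (p : U), x i p = e p i
  mem : ∀ a, ξ a ∈ 𝓜.gr U (𝓜.deg a)
  free : ∀ (V : Opens M) (h : V ≤ U) (f : 𝓜.O V),
    ∃! c : FibreExponent 𝓜.deg →₀ C^∞⟮𝓡 d, V; 𝓘(ℝ, ℝ), ℝ⟯,
      f = c.sum fun α g => 𝓜.fn V g * fibreMonomial (fun a => 𝓜.res h (ξ a)) α

/-- The coordinate functions `z = (x, ξ)` as functions on the graded manifold over `U`. -/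
noncomputable def coordinateFunction (𝓜 : GradedManifold.{u, v} d M) {U : Opens M}
    (x : Fin d → C^∞⟮𝓡 d, U; 𝓘(ℝ, ℝ), ℝ⟯) (ξ : Fin 𝓜.rank → 𝓜.O U) :
    Fin d ⊕ Fin 𝓜.rank → 𝓜.O U :=
  Sum.elim (fun i => 𝓜.fn U (x i)) ξ

end GradedManifold

/-! ### Symplectic Lie `n`-algebroids -/

/-- A symplectic Lie `n`-algebroid `(𝓜, {-,-}, Θ)`: a non-degenerate Poisson bracket of degree
`-n` on the functions of the graded manifold `𝓜` together with a function `Θ` of degree `n + 1`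
on `𝓜` with `{Θ, Θ} = 0`. In the signs, the shift by `-n` is replaced by the shift by `n`, which
has the same parity. -/
structure SymplecticLieAlgebroid {d : ℕ} {M : Type u} [TopologicalSpace M]
    [ChartedSpace (EuclideanSpace ℝ (Fin d)) M] [IsManifold (𝓡 d) ∞ M]
    (𝓜 : GradedManifold.{u, v} d M) (n : ℕ) where
  /-- the Poisson bracket -/
  bracket : ∀ U : Opens M, 𝓜.O U →ₗ[ℝ] 𝓜.O U →ₗ[ℝ] 𝓜.O U
  bracket_res : ∀ {U V : Opens M} (h : V ≤ U) (a b : 𝓜.O U),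
    𝓜.res h (bracket U a b) = bracket V (𝓜.res h a) (𝓜.res h b)
  /-- the bracket has degree `-n` -/
  bracket_mem : ∀ (U : Opens M) (i j k : ℕ) (a b : 𝓜.O U), a ∈ 𝓜.gr U i → b ∈ 𝓜.gr U j →
    i + j = k + n → bracket U a b ∈ 𝓜.gr U k
  bracket_eq_zero : ∀ (U : Opens M) (i j : ℕ) (a b : 𝓜.O U), a ∈ 𝓜.gr U i → b ∈ 𝓜.gr U j →
    i + j < n → bracket U a b = 0
  antisymm : ∀ (U : Opens M) (i j : ℕ) (a b : 𝓜.O U), a ∈ 𝓜.gr U i → b ∈ 𝓜.gr U j →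
    bracket U a b = -((-1 : ℝ) ^ ((i + n) * (j + n)) • bracket U b a)
  jacobi : ∀ (U : Opens M) (i j : ℕ) (a b c : 𝓜.O U), a ∈ 𝓜.gr U i → b ∈ 𝓜.gr U j →
    bracket U a (bracket U b c) = bracket U (bracket U a b) c +
      (-1 : ℝ) ^ ((i + n) * (j + n)) • bracket U b (bracket U a c)
  leibniz : ∀ (U : Opens M) (i j : ℕ) (a b c : 𝓜.O U), a ∈ 𝓜.gr U i → b ∈ 𝓜.gr U j →
    bracket U a (b * c) = bracket U a b * c + (-1 : ℝ) ^ ((i + n) * j) • (b * bracket U a c)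
  /-- In any local coordinates `z`, the matrix of the Poisson bivector is invertible. -/
  nondegenerate : ∀ (U : Opens M) (x : Fin d → C^∞⟮𝓡 d, U; 𝓘(ℝ, ℝ), ℝ⟯)
    (ξ : Fin 𝓜.rank → 𝓜.O U), 𝓜.IsCoordinates U x ξ →
    IsUnit (Matrix.of fun s t => bracket U (𝓜.coordinateFunction x ξ s)
      (𝓜.coordinateFunction x ξ t))
  /-- the Hamiltonian -/
  Θ : 𝓜.O ⊤
  Θ_mem : Θ ∈ 𝓜.gr ⊤ (n + 1)
  bracket_Θ_Θ : bracket ⊤ Θ Θ = 0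

/-! ### `L_∞`-algebras -/

/-- The Koszul sign `ε` in `x_1 ⋯ x_k = ε x_{σ 1} ⋯ x_{σ k}` for graded commuting `x_i` of
degree `deg i`. -/
noncomputable def koszulSign {k : ℕ} (deg : Fin k → ℤ) (σ : Equiv.Perm (Fin k)) : ℝ :=
  ∏ i : Fin k, ∏ j : Fin k, if i < j ∧ σ j < σ i then (-1 : ℝ) ^ (deg (σ i) * deg (σ j)) else 1

/-- The sign `χ` in `x_1 ∧ ⋯ ∧ x_k = χ x_{σ 1} ∧ ⋯ ∧ x_{σ k}` for `x_i` of degree `deg i`. -/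
noncomputable def antisymmetricSign {k : ℕ} (deg : Fin k → ℤ) (σ : Equiv.Perm (Fin k)) : ℝ :=
  ((Equiv.Perm.sign σ : ℤ) : ℝ) * koszulSign deg σ

/-- `σ` is a `(p, m - p)`-unshuffle. -/
def IsUnshuffle {m : ℕ} (p : ℕ) (σ : Equiv.Perm (Fin m)) : Prop :=
  ∀ a b : Fin m, a < b → (b.val < p ∨ p ≤ a.val) → σ a < σ b

open Classical in
/-- The products `μ 1, μ 2, …` form an `L_∞`-algebra structure on the `ℤ`-graded vector space
`L = ⨁ ℓ, gr ℓ`: `μ k` is graded antisymmetric of degree `2 - k`, and the homotopy Jacobi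
identities hold. In the latter, `p + 1` is the number of arguments of the inner product. There is
no product without arguments. -/
structure IsLInfinity {L : Type*} [AddCommGroup L] [Module ℝ L] (gr : ℤ → Submodule ℝ L)
    (μ : ∀ k : ℕ, MultilinearMap ℝ (fun _ : Fin k => L) L) : Prop where
  isInternal : DirectSum.IsInternal gr
  zero : μ 0 = 0
  degree : ∀ (k : ℕ) (deg : Fin k → ℤ) (x : Fin k → L), (∀ i, x i ∈ gr (deg i)) →
    μ k x ∈ gr (∑ i, deg i + 2 - k)
  antisymm : ∀ (k : ℕ) (deg : Fin k → ℤ) (x : Fin k → L), (∀ i, x i ∈ gr (deg i)) →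
    ∀ σ : Equiv.Perm (Fin k), μ k x = antisymmetricSign deg σ • μ k (x ∘ σ)
  jacobi : ∀ (m : ℕ) (deg : Fin m → ℤ) (x : Fin m → L), (∀ i, x i ∈ gr (deg i)) →
    ∑ p : Fin m, ∑ σ : Equiv.Perm (Fin m), (if IsUnshuffle (p.val + 1) σ then
      ((-1 : ℝ) ^ ((p.val + 1) * (m - (p.val + 1))) * antisymmetricSign deg σ) •
        μ (m - (p.val + 1) + 1)
          (Fin.cons (μ (p.val + 1) fun a : Fin (p.val + 1) => x (σ ⟨a.val, by omega⟩))
            fun b : Fin (m - (p.val + 1)) => x (σ ⟨p.val + 1 + b.val, by omega⟩))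
      else 0) = 0

/-- The graded vector space `⨁ ℓ, gr ℓ` is concentrated in degrees `1 - n, …, 0`. -/
def IsNTerm {L : Type*} [AddCommGroup L] [Module ℝ L] (n : ℕ) (gr : ℤ → Submodule ℝ L) : Prop :=
  ∀ ℓ : ℤ, gr ℓ ≠ ⊥ → 1 - (n : ℤ) ≤ ℓ ∧ ℓ ≤ 0

/-! ### The complex of an algebroid and the iterated brackets -/

namespace SymplecticLieAlgebroid

variable {d : ℕ} {M : Type u} [TopologicalSpace M]
  [ChartedSpace (EuclideanSpace ℝ (Fin d)) M] [IsManifold (𝓡 d) ∞ M]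
  {𝓜 : GradedManifold.{u, v} d M} {n : ℕ}

/-- `A_0 ⊕ ⋯ ⊕ A_{n-1}`, where `A_i` are the global functions of degree `i`. -/
def carrier (_A : SymplecticLieAlgebroid 𝓜 n) : Submodule ℝ (𝓜.O ⊤) :=
  ⨆ (i : ℕ) (_ : i < n), 𝓜.gr ⊤ i

/-- The grading of `A_0 ⊕ ⋯ ⊕ A_{n-1}` in which `A_i` has degree `i + 1 - n`. -/
def grading (A : SymplecticLieAlgebroid 𝓜 n) (ℓ : ℤ) : Submodule ℝ A.carrier :=
  if 1 - (n : ℤ) ≤ ℓ ∧ ℓ ≤ 0 then (𝓜.gr ⊤ (ℓ + n - 1).toNat).comap A.carrier.subtype else ⊥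

open Classical in
/-- On homogeneous functions: `δ e = {Θ, e}` for `e ∈ A_{n-1}`, and `δ e = 0` otherwise. -/
noncomputable def delta (A : SymplecticLieAlgebroid 𝓜 n) (e : 𝓜.O ⊤) : 𝓜.O ⊤ :=
  if e ∈ 𝓜.gr ⊤ (n - 1) then A.bracket ⊤ A.Θ e else 0

/-- `{…{{δ e_1, e_2}, e_3}…, e_k}` -/
noncomputable def derivedBracket (A : SymplecticLieAlgebroid 𝓜 n) : List (𝓜.O ⊤) → 𝓜.O ⊤
  | [] => 0
  | e :: l => l.foldl (fun a b => A.bracket ⊤ a b) (A.delta e)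

end SymplecticLieAlgebroid

/-- The sign in `s^{⊗k}(e_1 ⊗ ⋯ ⊗ e_k) = ± s e_{σ 1} ⋯ s e_{σ k}`, where `e_i` has degree `deg i`
and `s` lowers the degree by one, the `s e_i` graded commute, and `s` picks up a sign when passing
the `e_i`, that is, `s^{⊗k}(e_1 ⊗ ⋯ ⊗ e_k) = (-1)^{∑ (k - i) deg i} s e_1 ⊗ ⋯ ⊗ s e_k`. For all
`deg i = 0` this is the signature of `σ`. -/
noncomputable def suspendedKoszulSign {k : ℕ} (deg : Fin k → ℤ) (σ : Equiv.Perm (Fin k)) : ℝ :=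
  (-1 : ℝ) ^ (∑ i : Fin k, ((k : ℤ) - 1 - (i.val : ℤ)) * deg i) *
    koszulSign (fun i => deg i - 1) σ

/-!
Placing the functions of degree `i` in degree `i - n` turns the global functions into a
differential graded Lie algebra `G` with differential `Q = {Θ, -}`, see
`SymplecticLieAlgebroid.dgla`, and `A_0 ⊕ ⋯ ⊕ A_{n-1}` into its part `V` of negative degree. Only
this structure matters: `V` is the suspension of an `L_∞`-algebra for every differential graded Lie
algebra `G` (Getzler). Let `δ` be the composition of `Q` with the projection onto `G_{-1}`, and let
`f(z) = ∑ F_k z ^ k = z / (exp z - 1)`, so that `F_k = B_k / k!` (`bernoulliCoeff`).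

*The generating identity.* After tensoring with a Grassmann algebra (`envelopeBr`), a family of
homogeneous elements of `V` is replaced by a single even element `x`, and all signs disappear. With
`a = {-, x}` and `u = δ x`, the brackets are the Taylor coefficients of `E(x) = Q x - f(a) u`, and
the generalized Jacobi identities say that the derivative of `E` at `x` in the direction `E(x)`
vanishes. The derivative of `a ^ k u` in the direction `y` is
`a ^ k δ y + ∑_{i + j = k - 1} a ^ i {a ^ j u, y}` (`sum_nestedBracket_update`). The terms with `Q x`
cancel because `Q` is a derivation with `Q u = 0`, and for degree reasons the only
contribution of `δ` comes from `δ {u, x} = -{u, u}`. What remains is an identity between the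
`a ^ i {a ^ j u, a ^ l u}`. As `a` is a derivation of the symmetric bracket of odd elements, these
are the images of `(s + t) ^ i s ^ j t ^ l` under a linear map of `ℝ[s, t]` that does not
distinguish `s` and `t`, and the identity follows from
`t f(s) (f(s + t) - f(t)) + s f(t) (f(s + t) - f(s)) + s t f(s + t) = 0`, see
`sum_bernoulliCoeff_mul`, `sum_bernoulliCoeff_smul`, `sum_symmetricBracket`.

*Signs.* For `x = ∑ e_i ⊗ λ_i`, the coefficient of `λ_1 ⋯ λ_m` in the generating identity is the
Jacobi identity for `e_1, …, e_m` with Koszul signs, where the symmetrized sums have become sums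
over unshuffles (`sum_koszulBracket`). The factor `(-1) ^ ∑ (k - i) |e_i|` of the suspension turns
these signs into the ones of `IsLInfinity` (`pairSum_add_koszulExponent`, `product_cons_product`).
All signs are written as `paritySign` of an exponent in `ZMod 2`.
-/

/-! ### Signs -/

/-- The sign `(-1) ^ a` for an exponent `a` modulo two. -/
noncomputable def paritySign (a : ZMod 2) : ℝ := if a = 0 then 1 else -1

@[simp] lemma paritySign_zero : paritySign 0 = 1 := by simp [paritySign]

@[simp] lemma paritySign_one : paritySign 1 = -1 := by simp [paritySign]

lemma paritySign_add (a b : ZMod 2) : paritySign (a + b) = paritySign a * paritySign b := by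
  have h : ∀ c : ZMod 2, c = 0 ∨ c = 1 := by decide
  have h2 : (1 : ZMod 2) + 1 = 0 := by decide
  rcases h a with rfl | rfl <;> rcases h b with rfl | rfl <;> simp [h2]

lemma paritySign_mul_self (a : ZMod 2) : paritySign a * paritySign a = 1 := by
  rw [← paritySign_add, CharTwo.add_self_eq_zero, paritySign_zero]

lemma neg_paritySign (a : ZMod 2) : -paritySign a = paritySign (a + 1) := by
  rw [paritySign_add, paritySign_one, mul_neg_one]

lemma paritySign_sum {ι : Type*} (s : Finset ι) (f : ι → ZMod 2) :
    paritySign (∑ i ∈ s, f i) = ∏ i ∈ s, paritySign (f i) := by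
  classical
  induction s using Finset.induction_on with
  | empty => simp
  | insert i s hi ih => rw [Finset.sum_insert hi, Finset.prod_insert hi, paritySign_add, ih]

lemma neg_one_pow_eq_paritySign (k : ℕ) : (-1 : ℝ) ^ k = paritySign (k : ZMod 2) := by
  induction k with
  | zero => simp
  | succ k ih => rw [pow_succ, ih, Nat.cast_succ, paritySign_add, paritySign_one]

lemma neg_one_zpow_eq_paritySign (z : ℤ) : (-1 : ℝ) ^ z = paritySign (z : ZMod 2) := by
  rcases Int.even_or_odd z with h | h
  · rw [h.neg_one_zpow, (ZMod.intCast_eq_zero_iff_even).2 h, paritySign_zero]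
  · rw [h.neg_one_zpow, (ZMod.intCast_eq_one_iff_odd).2 h, paritySign_one]

/-- The sum of `A a b` over the pairs `a < b`. -/
def pairSum {k : ℕ} (A : Fin k → Fin k → ZMod 2) : ZMod 2 :=
  ∑ a, ∑ b, if a < b then A a b else 0

/-- The sum of `A (σ a) (σ b)` over the inversions `a < b`, `σ b < σ a` of a permutation. -/
def inversionSum {k : ℕ} (A : Fin k → Fin k → ZMod 2) (σ : Equiv.Perm (Fin k)) : ZMod 2 :=
  ∑ a, ∑ b, if a < b ∧ σ b < σ a then A (σ a) (σ b) else 0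

lemma pairSum_add {k : ℕ} (A B : Fin k → Fin k → ZMod 2) :
    pairSum (fun a b => A a b + B a b) = pairSum A + pairSum B := by
  simp only [pairSum, ← Finset.sum_add_distrib]
  refine Finset.sum_congr rfl fun a _ => Finset.sum_congr rfl fun b _ => ?_
  split_ifs <;> simp

lemma inversionSum_add {k : ℕ} (A B : Fin k → Fin k → ZMod 2) (σ : Equiv.Perm (Fin k)) :
    inversionSum (fun a b => A a b + B a b) σ = inversionSum A σ + inversionSum B σ := by
  simp only [inversionSum, ← Finset.sum_add_distrib]
  refine Finset.sum_congr rfl fun a _ => Finset.sum_congr rfl fun b _ => ?_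
  split_ifs <;> simp

/-- Permuting the indices changes a sum over pairs by the contributions of the inversions. -/
lemma pairSum_comp_perm {k : ℕ} (A : Fin k → Fin k → ZMod 2) (σ : Equiv.Perm (Fin k)) :
    pairSum (fun a b => A (σ a) (σ b)) =
      pairSum A + inversionSum (fun a b => A a b + A b a) σ := by
  have h1 : pairSum A = ∑ a, ∑ b, if σ a < σ b then A (σ a) (σ b) else 0 := by
    rw [pairSum, ← Equiv.sum_comp σ]
    refine Finset.sum_congr rfl fun a _ => ?_
    rw [← Equiv.sum_comp σ]
  have h2 : ∑ a, ∑ b, (if σ a < σ b then A (σ a) (σ b) else 0) =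
      ∑ a, ∑ b, ((if a < b ∧ σ a < σ b then A (σ a) (σ b) else 0) +
        if b < a ∧ σ a < σ b then A (σ a) (σ b) else 0) := by
    refine Finset.sum_congr rfl fun a _ => Finset.sum_congr rfl fun b _ => ?_
    rcases lt_trichotomy a b with h | h | h
    · simp [h, h.asymm]
    · simp [h]
    · simp [h, h.asymm]
  have h3 : ∑ a, ∑ b, (if b < a ∧ σ a < σ b then A (σ a) (σ b) else 0) =
      ∑ a, ∑ b, if a < b ∧ σ b < σ a then A (σ b) (σ a) else 0 := Finset.sum_comm
  rw [h1, h2]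
  simp only [Finset.sum_add_distrib]
  rw [h3]
  simp only [pairSum, inversionSum, ← Finset.sum_add_distrib]
  refine Finset.sum_congr rfl fun a _ => Finset.sum_congr rfl fun b _ => ?_
  rcases lt_trichotomy (σ a) (σ b) with h | h | h
  · simp [h, h.asymm]
  · have : a = b := σ.injective h
    simp [this]
  · have e : A (σ b) (σ a) + A (σ b) (σ a) = 0 := CharTwo.add_self_eq_zero _
    by_cases hab : a < b
    · simp only [hab, h, h.asymm]; simp only [if_true, and_true, and_false, if_false, zero_add]
      linear_combination -e
    · simp [hab]

lemma pairSum_succ {k : ℕ} (A : Fin (k + 1) → Fin (k + 1) → ZMod 2) :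
    pairSum A = pairSum (fun a b : Fin k => A a.castSucc b.castSucc) +
      ∑ a : Fin k, A a.castSucc (Fin.last k) := by
  simp [pairSum, Fin.sum_univ_castSucc, Finset.sum_add_distrib, Fin.castSucc_lt_last,
    fun i : Fin k => (Fin.castSucc_lt_last i).not_gt]

lemma pairSum_cons {k : ℕ} (A : Fin (k + 1) → Fin (k + 1) → ZMod 2) :
    pairSum A = ∑ b : Fin k, A 0 b.succ + pairSum (fun a b : Fin k => A a.succ b.succ) := by
  simp [pairSum, Fin.sum_univ_succ]

/-- The exponent of the Koszul sign of a permutation of elements of parities `q`. -/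
def koszulExponent {k : ℕ} (q : Fin k → ZMod 2) (σ : Equiv.Perm (Fin k)) : ZMod 2 :=
  inversionSum (fun a b => q a * q b) σ

lemma koszulSign_eq {k : ℕ} (deg : Fin k → ℤ) (σ : Equiv.Perm (Fin k)) :
    koszulSign deg σ = paritySign (koszulExponent (fun i => (deg i : ZMod 2)) σ) := by
  simp only [koszulSign, koszulExponent, inversionSum, paritySign_sum]
  refine Finset.prod_congr rfl fun a _ => Finset.prod_congr rfl fun b _ => ?_
  split_ifs
  · rw [neg_one_zpow_eq_paritySign]; push_cast; rfl
  · simp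

lemma sign_eq_paritySign {k : ℕ} (σ : Equiv.Perm (Fin k)) :
    ((Equiv.Perm.sign σ : ℤ) : ℝ) = paritySign (inversionSum (fun _ _ => 1) σ) := by
  rw [Equiv.Perm.sign_eq_prod_prod_Ioi]
  simp only [inversionSum, paritySign_sum]
  push_cast
  refine Finset.prod_congr rfl fun a _ => ?_
  rw [← Finset.prod_subset (Finset.subset_univ (Finset.Ioi a))]
  · refine Finset.prod_congr rfl fun b hb => ?_
    have hb : a < b := by simpa using hb
    rcases lt_trichotomy (σ a) (σ b) with h | h | h
    · simp [h, h.asymm]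
    · exact absurd (σ.injective h) hb.ne
    · simp [h, h.asymm, hb]
  · intro b _ hb
    have hb : ¬ a < b := by simpa using hb
    simp [hb]

/-! ### Sums over functions and over strictly monotone functions -/

/-- A function that is invariant under reordering and vanishes on non-injective families is
determined by its values on strictly monotone families. -/
lemma sum_eq_factorial_smul_sum_strictMono {H : Type*} [AddCommGroup H] [Module ℝ H] {m k : ℕ}
    (K : (Fin k → Fin m) → H) (hperm : ∀ (f : Fin k → Fin m) (τ : Equiv.Perm (Fin k)),
      K (f ∘ τ) = K f) (hinj : ∀ f, ¬ Function.Injective f → K f = 0) :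
    ∑ f, K f = (k.factorial : ℝ) • ∑ f, if StrictMono f then K f else 0 := by
  have h1 : ∀ f, K f = ∑ τ : Equiv.Perm (Fin k), if StrictMono (f ∘ τ) then K (f ∘ τ) else 0 := by
    intro f
    by_cases hf : Function.Injective f
    · rw [Finset.sum_eq_single (Tuple.sort f)]
      · rw [if_pos, hperm]
        exact (Tuple.monotone_sort f).strictMono_of_injective (hf.comp (Equiv.injective _))
      · intro τ _ hτ
        rw [if_neg]
        intro h
        apply hτ
        have := Tuple.unique_monotone h.monotone (Tuple.monotone_sort f)
        ext a
        exact congrArg _ (hf (congrFun this a))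
      · simp
    · rw [hinj f hf]
      refine (Finset.sum_eq_zero fun τ _ => ?_).symm
      rw [if_neg]
      intro h
      exact hf ((Function.Injective.of_comp_iff' f τ.bijective).1 h.injective)
  have h2 : ∀ τ : Equiv.Perm (Fin k),
      ∑ f : Fin k → Fin m, (if StrictMono (f ∘ τ) then K (f ∘ τ) else 0) =
        ∑ f, if StrictMono f then K f else 0 := by
    intro τ
    exact Equiv.sum_comp (Equiv.arrowCongr τ.symm (Equiv.refl (Fin m)))
      (fun f => if StrictMono f then K f else 0)
  rw [Finset.sum_congr rfl fun f _ => h1 f, Finset.sum_comm, Finset.sum_congr rfl fun τ _ => h2 τ,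
    Finset.sum_const, Finset.card_univ, Fintype.card_perm, Fintype.card_fin,
    ← Nat.cast_smul_eq_nsmul ℝ]

/-- In a sum over permutations, each index occurs equally often in the first place. -/
lemma sum_perm_apply_zero {H : Type*} [AddCommGroup H] [Module ℝ H] {k : ℕ}
    (K : Fin (k + 1) → H) :
    ∑ ρ : Equiv.Perm (Fin (k + 1)), K (ρ 0) = (k.factorial : ℝ) • ∑ j, K j := by
  rw [← Equiv.sum_comp Equiv.Perm.decomposeFin.symm, Fintype.sum_prod_type]
  simp only [Equiv.Perm.decomposeFin_symm_apply_zero, Finset.sum_const, Finset.card_univ,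
    Fintype.card_perm, Fintype.card_fin, ← Nat.cast_smul_eq_nsmul ℝ, Finset.smul_sum]

/-! ### An identity between Bernoulli numbers -/

/-- The coefficients of `t / (exp t - 1)`. -/
noncomputable def bernoulliCoeff (k : ℕ) : ℝ := ((bernoulli k : ℚ) : ℝ) / (k.factorial : ℝ)

section Bernoulli

open PowerSeries

/-- For `f t = t / (exp t - 1)` one has
`t f(s) (f(s + t) - f(t)) + s f(t) (f(s + t) - f(s)) + s t f(s + t) = 0`. This is the coefficient
of `z ^ (N + 1)` of this identity at `z s`, `z t`. -/
lemma sum_bernoulliCoeff_mul {R : Type*} [CommRing R] [IsDomain R] [Algebra ℝ R] (s t : R)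
    (hs : s ≠ 0) (ht : t ≠ 0) (hst : s + t ≠ 0) (N : ℕ) :
    ∑ i ∈ Finset.HasAntidiagonal.antidiagonal (N + 1),
      algebraMap ℝ R (bernoulliCoeff i.1 * bernoulliCoeff i.2) *
        (t * s ^ i.2 * ((s + t) ^ i.1 - t ^ i.1) + s * t ^ i.2 * ((s + t) ^ i.1 - s ^ i.1)) +
      algebraMap ℝ R (bernoulliCoeff N) * (s * t * (s + t) ^ N) = 0 := by
  let _ : Algebra ℚ R := ((algebraMap ℝ R).comp (algebraMap ℚ ℝ)).toAlgebra
  set f : R → R⟦X⟧ := fun a => rescale a (bernoulliPowerSeries R) with hf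
  set E : R → R⟦X⟧ := fun a => rescale a (exp R) with hE
  have hcoeff : ∀ a k, coeff k (f a) = algebraMap ℝ R (bernoulliCoeff k) * a ^ k := by
    intro a k
    simp only [hf, coeff_rescale, bernoulliPowerSeries, coeff_mk, bernoulliCoeff]
    rw [mul_comm]
    congr 1
    change (algebraMap ℝ R) (algebraMap ℚ ℝ _) = _
    congr 1
    simp
  have hfe : ∀ a, f a * (E a - 1) = C a * X := by
    intro a
    have := congrArg (rescale a) (bernoulliPowerSeries_mul_exp_sub_one R)
    simpa [map_mul, map_sub, rescale_X] using this
  have hne : ∀ a, a ≠ 0 → E a - 1 ≠ 0 := by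
    intro a ha h
    have := congrArg (coeff 1) h
    simp [hE, coeff_rescale, coeff_exp, coeff_one] at this
    exact ha this
  have hadd : E s * E t = E (s + t) := exp_mul_exp_eq_exp_add s t
  have key : C t * f s * (f (s + t) - f t) + C s * f t * (f (s + t) - f s) +
      C s * C t * X * f (s + t) = 0 := by
    have h1 := hfe s
    have h2 := hfe t
    have h3 := hfe (s + t)
    rw [← hadd] at h3
    have h4 := hne (s + t) hst
    rw [← hadd] at h4
    have h5 := hne s hs
    have h6 := hne t ht
    rw [map_add] at h3
    have : (C t * f s * (f (s + t) - f t) + C s * f t * (f (s + t) - f s) +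
      C s * C t * X * f (s + t)) * ((E s - 1) * (E t - 1) * (E s * E t - 1)) = 0 := by
      linear_combination (C t * (E t - 1) * (f (s + t) * (E s * E t - 1)) -
        (C s + C t) * (E s * E t - 1) * (f t * (E t - 1))) * h1 +
        (C s * (E s - 1) * (f (s + t) * (E s * E t - 1)) -
          (C s + C t) * (E s * E t - 1) * (C s * X)) * h2 +
        (C t * (E t - 1) * (C s * X) + C s * (E s - 1) * (C t * X) +
          C s * C t * X * (E s - 1) * (E t - 1)) * h3
    exact (mul_eq_zero.1 this).resolve_right (mul_ne_zero (mul_ne_zero h5 h6) h4)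
  have key2 : C t * ((f (s + t) - f t) * f s) + C s * ((f (s + t) - f s) * f t) +
      C (s * t) * (f (s + t) * X) = 0 := by
    rw [map_mul]
    linear_combination key
  have h := congrArg (coeff (N + 1)) key2
  simp only [map_add, coeff_C_mul, coeff_mul (N + 1) (f (s + t) - _), coeff_succ_mul_X, hcoeff,
    map_sub, map_zero, Finset.mul_sum, ← Finset.sum_add_distrib] at h
  rw [← h]
  congr 1
  · refine Finset.sum_congr rfl fun i _ => ?_
    rw [map_mul]
    ring
  · ring

end Bernoulli

/-- The combination of iterated brackets that makes the generalized Jacobi identities hold.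
Here `c p q` stands for `[a ^ p u, a ^ q u]` with `a` a derivation of a symmetric bracket, and
`D k l` for `∑ i + j = k - 1, a ^ i [a ^ j u, a ^ l u]`. -/
lemma sum_bernoulliCoeff_smul {H : Type*} [AddCommGroup H] [Module ℝ H] (a : H →ₗ[ℝ] H)
    (c D : ℕ → ℕ → H) (hc : ∀ p q, a (c p q) = c (p + 1) q + c p (q + 1))
    (hsymm : ∀ p q, c p q = c q p) (hD0 : ∀ l, D 0 l = 0)
    (hD : ∀ k l, D (k + 1) l = a (D k l) + c k l) (N : ℕ) :
    ∑ i ∈ Finset.HasAntidiagonal.antidiagonal (N + 1),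
        (bernoulliCoeff i.1 * bernoulliCoeff i.2) • D i.1 i.2 +
      (bernoulliCoeff N / 2) • (a ^ N) (c 0 0) = 0 := by
  classical
  -- `Φ` sends `s ^ p * t ^ q` to `[a ^ p u, a ^ q u]`, so that multiplication by `s + t`
  -- becomes `a`.
  set s : MvPolynomial (Fin 2) ℝ := MvPolynomial.X 0 with hs
  set t : MvPolynomial (Fin 2) ℝ := MvPolynomial.X 1 with ht
  let Φ : MvPolynomial (Fin 2) ℝ →ₗ[ℝ] H :=
    (MvPolynomial.basisMonomials (Fin 2) ℝ).constr ℝ fun e => c (e 0) (e 1)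
  have hmon : ∀ p q : ℕ, s ^ p * t ^ q =
      MvPolynomial.monomial (Finsupp.single 0 p + Finsupp.single 1 q) (1 : ℝ) := by
    intro p q
    rw [hs, ht, MvPolynomial.X_pow_eq_monomial, MvPolynomial.X_pow_eq_monomial,
      MvPolynomial.monomial_mul, one_mul]
  have hΦmon : ∀ e, Φ (MvPolynomial.monomial e 1) = c (e 0) (e 1) := by
    intro e
    have := (MvPolynomial.basisMonomials (Fin 2) ℝ).constr_basis ℝ (fun e => c (e 0) (e 1)) e
    rwa [MvPolynomial.coe_basisMonomials] at this
  have hΦ : ∀ p q : ℕ, Φ (s ^ p * t ^ q) = c p q := by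
    intro p q
    rw [hmon, hΦmon]
    simp
  -- The operators below are compared on the monomials `s ^ p * t ^ q`.
  have hext : ∀ {f g : MvPolynomial (Fin 2) ℝ →ₗ[ℝ] H},
      (∀ p q, f (s ^ p * t ^ q) = g (s ^ p * t ^ q)) → f = g := by
    intro f g h
    refine (MvPolynomial.basisMonomials (Fin 2) ℝ).ext fun e => ?_
    have he : e = Finsupp.single 0 (e 0) + Finsupp.single 1 (e 1) := by
      ext i
      fin_cases i <;> simp
    rw [MvPolynomial.coe_basisMonomials]
    beta_reduce
    rw [he, ← hmon, h]
  have hΦa : ∀ P, Φ ((s + t) * P) = a (Φ P) := by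
    intro P
    refine LinearMap.congr_fun (f := Φ ∘ₗ LinearMap.mulLeft ℝ (s + t)) (g := a ∘ₗ Φ)
      (hext fun p q => ?_) P
    simp only [LinearMap.comp_apply, LinearMap.mulLeft_apply]
    rw [hΦ, hc, ← hΦ, ← hΦ p, ← map_add]
    congr 1
    ring
  let w : MvPolynomial (Fin 2) ℝ →ₐ[ℝ] MvPolynomial (Fin 2) ℝ :=
    MvPolynomial.rename (Equiv.swap 0 1)
  have hws : w s = t := by simp [w, hs, ht]
  have hwt : w t = s := by simp [w, hs, ht]
  have hΦw : ∀ P, Φ (w P) = Φ P := by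
    intro P
    refine LinearMap.congr_fun (f := Φ ∘ₗ w.toLinearMap) (g := Φ) (hext fun p q => ?_) P
    simp only [LinearMap.comp_apply, AlgHom.toLinearMap_apply, map_mul, map_pow, hws, hwt]
    rw [mul_comm, hΦ, hΦ, hsymm]
  -- `E k = ((s + t) ^ k - s ^ k) / t`, so that `E k * t ^ l` corresponds to `D k l`.
  let E : ℕ → MvPolynomial (Fin 2) ℝ := fun k => Nat.rec 0 (fun k e => (s + t) * e + s ^ k) k
  have hE : ∀ k, E (k + 1) = (s + t) * E k + s ^ k := fun _ => rfl
  have hEt : ∀ k, E k * t = (s + t) ^ k - s ^ k := by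
    intro k
    induction k with
    | zero => simp [E]
    | succ k ih => rw [hE, add_mul, mul_assoc, ih]; ring
  have hDE : ∀ k l, D k l = Φ (E k * t ^ l) := by
    intro k l
    induction k with
    | zero => simp [hD0, E]
    | succ k ih => rw [hD, ih, hE, ← hΦa, ← hΦ, ← map_add]; congr 1; ring
  have haN : (a ^ N) (c 0 0) = Φ ((s + t) ^ N) := by
    clear_value s t
    induction N with
    | zero => simpa using (hΦ 0 0).symm
    | succ N ih => rw [pow_succ', Module.End.mul_apply, ih, ← hΦa, pow_succ']
  have hs0 : s ≠ 0 := MvPolynomial.X_ne_zero _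
  have ht0 : t ≠ 0 := MvPolynomial.X_ne_zero _
  have hst0 : s + t ≠ 0 := by
    intro h
    have := congrArg (MvPolynomial.eval (fun _ => (1 : ℝ))) h
    norm_num [hs, ht] at this
  let P : MvPolynomial (Fin 2) ℝ := ∑ i ∈ Finset.HasAntidiagonal.antidiagonal (N + 1),
    (bernoulliCoeff i.1 * bernoulliCoeff i.2) • (E i.1 * t ^ i.2) +
      (bernoulliCoeff N / 2) • (s + t) ^ N
  -- As `Φ` is invariant under exchanging `s` and `t`, only the symmetrization of `P` has to vanish.
  have hP : P + w P = 0 := by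
    have h := sum_bernoulliCoeff_mul s t hs0 ht0 hst0 N
    have hwE : ∀ k, w (E k) * s = (s + t) ^ k - t ^ k := by
      intro k
      have := congrArg w (hEt k)
      simpa [map_mul, hws, hwt, add_comm t s] using this
    refine (mul_eq_zero.1 (?_ : (s * t) * (P + w P) = 0)).resolve_left (mul_ne_zero hs0 ht0)
    have hwP : w P = ∑ i ∈ Finset.HasAntidiagonal.antidiagonal (N + 1),
        (bernoulliCoeff i.1 * bernoulliCoeff i.2) • (w (E i.1) * s ^ i.2) +
          (bernoulliCoeff N / 2) • (t + s) ^ N := by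
      simp only [P, map_add, map_sum, map_smul, map_mul, map_pow, hws, hwt]
    rw [← h, hwP, mul_add, mul_add, mul_add, Finset.mul_sum, Finset.mul_sum]
    simp only [MvPolynomial.smul_eq_C_mul, MvPolynomial.algebraMap_eq]
    have e1 : ∀ i : ℕ × ℕ, s * t * (MvPolynomial.C (bernoulliCoeff i.1 * bernoulliCoeff i.2) *
        (E i.1 * t ^ i.2)) + s * t * (MvPolynomial.C (bernoulliCoeff i.1 * bernoulliCoeff i.2) *
        (w (E i.1) * s ^ i.2)) = MvPolynomial.C (bernoulliCoeff i.1 * bernoulliCoeff i.2) *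
        (t * s ^ i.2 * ((s + t) ^ i.1 - t ^ i.1) + s * t ^ i.2 * ((s + t) ^ i.1 - s ^ i.1)) := by
      intro i
      rw [← hEt, ← hwE]
      ring
    have e2 : (MvPolynomial.C (bernoulliCoeff N / 2) : MvPolynomial (Fin 2) ℝ) +
        MvPolynomial.C (bernoulliCoeff N / 2) = MvPolynomial.C (bernoulliCoeff N) := by
      rw [← map_add, add_halves]
    rw [← e2, ← Finset.sum_congr rfl fun i _ => e1 i, Finset.sum_add_distrib]
    ring
  have hΦP : Φ P = 0 := by
    have h2 : (2 : ℝ) • Φ P = 0 := by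
      rw [two_smul]
      nth_rewrite 2 [← hΦw]
      rw [← map_add, hP, map_zero]
    exact (smul_eq_zero.1 h2).resolve_left two_ne_zero
  simpa only [P, map_add, map_sum, map_smul, ← hDE, ← haN] using hΦP

/-! ### Differential graded Lie algebras -/

/-- A differential graded Lie algebra `G = ⨁ i, G_i` together with a part `V` of negative degree,
of which only the parity of degrees is remembered: `π` is the parity operator, `br` the graded Lie
bracket, `Q` the differential, and `δ` is the composition of `Q` with the projection
onto `G_{-1}`. The laws for `δ` and `V` are what the degrees imply for the latter. -/
structure TruncatedDGLA (G : Type*) [AddCommGroup G] [Module ℝ G] where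
  br : G →ₗ[ℝ] G →ₗ[ℝ] G
  π : G →ₗ[ℝ] G
  Q : G →ₗ[ℝ] G
  δ : G →ₗ[ℝ] G
  V : Submodule ℝ G
  π_π : ∀ g, π (π g) = g
  π_br : ∀ g h, π (br g h) = br (π g) (π h)
  antisymm : ∀ (p q : ZMod 2) (g h : G), π g = paritySign p • g → π h = paritySign q • h →
    br g h = -(paritySign (p * q) • br h g)
  jacobi : ∀ (p q : ZMod 2) (g h k : G), π g = paritySign p • g → π h = paritySign q • h →
    br g (br h k) = br (br g h) k + paritySign (p * q) • br h (br g k)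
  π_Q : ∀ g, π (Q g) = -Q (π g)
  Q_br : ∀ (p : ZMod 2) (g h : G), π g = paritySign p • g →
    Q (br g h) = br (Q g) h + paritySign p • br g (Q h)
  Q_Q : ∀ g, Q (Q g) = 0
  π_δ : ∀ g, π (δ g) = δ g
  δ_π : ∀ g, δ (π g) = -δ g
  Q_δ : ∀ g, Q (δ g) = 0
  δ_Q : ∀ g, δ (Q g) = 0
  δ_δ : ∀ g, δ (δ g) = 0
  δ_br_δ : ∀ g h, δ (br (δ g) h) = br (δ g) (δ h)
  π_mem : ∀ g ∈ V, π g ∈ V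
  br_mem : ∀ g ∈ V, ∀ h ∈ V, br g h ∈ V
  br_δ_mem : ∀ g, ∀ h ∈ V, br (δ g) h ∈ V
  δ_br : ∀ g ∈ V, ∀ h ∈ V, δ (br g h) = 0
  Q_sub_δ_mem : ∀ g ∈ V, Q g - δ g ∈ V

namespace TruncatedDGLA

variable {G : Type*} [AddCommGroup G] [Module ℝ G] (A : TruncatedDGLA G)

/-- `g` is homogeneous of parity `p`. -/
def IsHomog (p : ZMod 2) (g : G) : Prop := A.π g = paritySign p • g

/-- The power `π ^ p`, that is, the sign of moving an element of parity `p` past the argument. -/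
def twist (p : ZMod 2) : G →ₗ[ℝ] G := if p = 0 then LinearMap.id else A.π

variable {A}

lemma twist_of_isHomog {p q : ZMod 2} {g : G} (hg : A.IsHomog q g) :
    A.twist p g = paritySign (p * q) • g := by
  have h : ∀ c : ZMod 2, c = 0 ∨ c = 1 := by decide
  rcases h p with rfl | rfl
  · simp [twist]
  · simpa [twist, IsHomog] using hg

lemma IsHomog.zero (p : ZMod 2) : A.IsHomog p 0 := by simp [IsHomog]

lemma IsHomog.br {p q : ZMod 2} {g h : G} (hg : A.IsHomog p g) (hh : A.IsHomog q h) :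
    A.IsHomog (p + q) (A.br g h) := by
  rw [IsHomog, A.π_br, hg, hh, paritySign_add]
  simp [smul_smul, mul_comm]

lemma IsHomog.smul {p : ZMod 2} {g : G} (hg : A.IsHomog p g) (c : ℝ) : A.IsHomog p (c • g) := by
  rw [IsHomog, map_smul, hg, smul_comm]

lemma IsHomog.sum {ι : Type*} {s : Finset ι} {p : ZMod 2} {g : ι → G}
    (hg : ∀ i ∈ s, A.IsHomog p (g i)) : A.IsHomog p (∑ i ∈ s, g i) := by
  rw [IsHomog, map_sum, Finset.smul_sum]
  exact Finset.sum_congr rfl hg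

lemma IsHomog.sub {p : ZMod 2} {g h : G} (hg : A.IsHomog p g) (hh : A.IsHomog p h) :
    A.IsHomog p (g - h) := by
  rw [IsHomog, map_sub, hg, hh, smul_sub]

lemma IsHomog.Q {p : ZMod 2} {g : G} (hg : A.IsHomog p g) : A.IsHomog (p + 1) (A.Q g) := by
  rw [IsHomog, A.π_Q, hg, map_smul, ← neg_paritySign, neg_smul]

lemma isHomog_δ (g : G) : A.IsHomog 0 (A.δ g) := by simp [IsHomog, A.π_δ]

/-- The map `δ` vanishes on even elements because it is supported in the odd degree `-1`. -/
lemma δ_eq_zero {g : G} (hg : A.IsHomog 0 g) : A.δ g = 0 := by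
  have h1 := A.δ_π g
  rw [hg, paritySign_zero, one_smul] at h1
  have h2 : (2 : ℝ) • A.δ g = 0 := by rw [two_smul]; nth_rewrite 1 [h1]; simp
  exact (smul_eq_zero.1 h2).resolve_left two_ne_zero

lemma IsHomog.δ {p : ZMod 2} {g : G} (hg : A.IsHomog p g) : A.IsHomog (p + 1) (A.δ g) := by
  have h : ∀ c : ZMod 2, c = 0 ∨ c = 1 := by decide
  rcases h p with rfl | rfl
  · rw [δ_eq_zero hg]; exact IsHomog.zero _
  · exact isHomog_δ g

lemma Q_twist (p : ZMod 2) (g : G) : A.Q (A.twist p g) = paritySign p • A.twist p (A.Q g) := by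
  have h : ∀ c : ZMod 2, c = 0 ∨ c = 1 := by decide
  rcases h p with rfl | rfl
  · simp [twist]
  · simp [twist, A.π_Q]

lemma twist_mem (p : ZMod 2) {g : G} (hg : g ∈ A.V) : A.twist p g ∈ A.V := by
  unfold twist
  split_ifs
  · exact hg
  · exact A.π_mem g hg

lemma δ_twist (p : ZMod 2) (g : G) : A.δ (A.twist p g) = paritySign p • A.δ g := by
  have h : ∀ c : ZMod 2, c = 0 ∨ c = 1 := by decide
  rcases h p with rfl | rfl
  · simp [twist]
  · simp [twist, A.δ_π]

lemma twist_δ (p : ZMod 2) (g : G) : A.twist p (A.δ g) = A.δ g := by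
  rw [twist_of_isHomog (isHomog_δ g), mul_zero, paritySign_zero, one_smul]

end TruncatedDGLA

/-! ### The Grassmann envelope -/

section Envelope

variable {ι : Type*} [LinearOrder ι]

/-- For variables `λ_i` of parity `d i` and disjoint `T` and `U`, the product `λ_T λ_U` is
`(-1) ^ crossing d T U` times `λ_{T ∪ U}`, where `λ_T` is the product of the `λ_i`, `i ∈ T`, in
increasing order. -/
def crossing (d : ι → ZMod 2) (T U : Finset ι) : ZMod 2 :=
  ∑ t ∈ T, ∑ u ∈ U, if u < t then d t * d u else 0

lemma crossing_union_left (d : ι → ZMod 2) {T U : Finset ι} (h : Disjoint T U) (W : Finset ι) :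
    crossing d (T ∪ U) W = crossing d T W + crossing d U W := Finset.sum_union h

lemma crossing_union_right (d : ι → ZMod 2) {U W : Finset ι} (h : Disjoint U W) (T : Finset ι) :
    crossing d T (U ∪ W) = crossing d T U + crossing d T W := by
  simp only [crossing, Finset.sum_union h, Finset.sum_add_distrib]

lemma crossing_add_crossing (d : ι → ZMod 2) {T U : Finset ι} (h : Disjoint T U) :
    crossing d T U + crossing d U T = (∑ t ∈ T, d t) * ∑ u ∈ U, d u := by
  rw [crossing, crossing, Finset.sum_comm (s := U), Finset.sum_mul_sum, ← Finset.sum_add_distrib]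
  refine Finset.sum_congr rfl fun t ht => ?_
  rw [← Finset.sum_add_distrib]
  refine Finset.sum_congr rfl fun u hu => ?_
  rcases lt_trichotomy t u with h' | h' | h'
  · simp [h', h'.asymm, mul_comm]
  · exact absurd h' (Finset.disjoint_left.1 h ht |> fun hn e => hn (e ▸ hu))
  · simp [h', h'.asymm]

namespace TruncatedDGLA

variable {G : Type*} [AddCommGroup G] [Module ℝ G] (A : TruncatedDGLA G) [Fintype ι]
  (d : ι → ZMod 2)

open Classical in
/-- The bracket of the Grassmann envelope `G ⊗ Λ`, where `Λ` is the graded commutative algebra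
generated by variables `λ_i` of parity `d i` subject to `λ_i ^ 2 = 0`. The function
`F : Finset ι → G` stands for the element `∑ T, F T ⊗ λ_T`. The operator `twist` is the sign of
moving `λ_T` past `F' U`. -/
noncomputable def envelopeBr : (Finset ι → G) →ₗ[ℝ] (Finset ι → G) →ₗ[ℝ] (Finset ι → G) :=
  LinearMap.mk₂ ℝ (fun F F' S => ∑ T, ∑ U, if Disjoint T U ∧ T ∪ U = S then
      paritySign (crossing d T U) • A.br (F T) (A.twist (∑ t ∈ T, d t) (F' U)) else 0)
    (fun F F' F'' => by
      ext S
      simp only [Pi.add_apply, ← Finset.sum_add_distrib]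
      refine Finset.sum_congr rfl fun T _ => Finset.sum_congr rfl fun U _ => ?_
      split_ifs <;> simp)
    (fun c F F' => by
      ext S
      simp only [Pi.smul_apply, Finset.smul_sum]
      refine Finset.sum_congr rfl fun T _ => Finset.sum_congr rfl fun U _ => ?_
      split_ifs
      · simp [smul_comm c]
      · simp)
    (fun F F' F'' => by
      ext S
      simp only [Pi.add_apply, ← Finset.sum_add_distrib]
      refine Finset.sum_congr rfl fun T _ => Finset.sum_congr rfl fun U _ => ?_
      split_ifs <;> simp)
    (fun c F F' => by
      ext S
      simp only [Pi.smul_apply, Finset.smul_sum]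
      refine Finset.sum_congr rfl fun T _ => Finset.sum_congr rfl fun U _ => ?_
      split_ifs
      · simp [smul_comm c]
      · simp)

/-- `F` is homogeneous of total parity `p`. -/
def IsEnvelopeHomog (p : ZMod 2) (F : Finset ι → G) : Prop :=
  ∀ S, A.IsHomog ((∑ i ∈ S, d i) + p) (F S)

variable {A d}

open Classical in
lemma envelopeBr_apply (F F' : Finset ι → G) (S : Finset ι) :
    A.envelopeBr d F F' S = ∑ T, ∑ U, if Disjoint T U ∧ T ∪ U = S then
      paritySign (crossing d T U) • A.br (F T) (A.twist (∑ t ∈ T, d t) (F' U)) else 0 := rfl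

open Classical in
lemma envelopeBr_single {q : ZMod 2} (T U : Finset ι) (g : G) {h : G} (hh : A.IsHomog q h) :
    A.envelopeBr d (Pi.single T g) (Pi.single U h) = if Disjoint T U then
      Pi.single (T ∪ U) (paritySign (crossing d T U + (∑ t ∈ T, d t) * q) • A.br g h) else 0 := by
  ext S
  rw [envelopeBr_apply, Finset.sum_eq_single T, Finset.sum_eq_single U]
  · by_cases hTU : Disjoint T U
    · by_cases hS : T ∪ U = S
      · subst hS
        simp [hTU, twist_of_isHomog hh, paritySign_add, smul_smul]
      · simp [hTU, hS]
    · simp [hTU]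
  · intro U' _ hU'
    simp [Pi.single_eq_of_ne hU']
  · simp
  · intro T' _ hT'
    simp [Pi.single_eq_of_ne hT']
  · simp

lemma IsEnvelopeHomog.envelopeBr {p q : ZMod 2} {F F' : Finset ι → G}
    (hF : A.IsEnvelopeHomog d p F) (hF' : A.IsEnvelopeHomog d q F') :
    A.IsEnvelopeHomog d (p + q) (A.envelopeBr d F F') := by
  intro S
  rw [envelopeBr_apply]
  refine IsHomog.sum fun T _ => IsHomog.sum fun U _ => ?_
  split_ifs with h
  · rw [twist_of_isHomog (hF' U), map_smul, ← h.2, Finset.sum_union h.1]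
    have := (((hF T).br (hF' U)).smul (paritySign ((∑ t ∈ T, d t) * ((∑ u ∈ U, d u) + q)))).smul
      (paritySign (crossing d T U))
    convert this using 1
    ring
  · exact IsHomog.zero _

/-- The bracket of the Grassmann envelope is symmetric on odd elements. -/
lemma envelopeBr_symm {F F' : Finset ι → G} (hF : A.IsEnvelopeHomog d 1 F)
    (hF' : A.IsEnvelopeHomog d 1 F') : A.envelopeBr d F F' = A.envelopeBr d F' F := by
  ext S
  rw [envelopeBr_apply, envelopeBr_apply, Finset.sum_comm]
  refine Finset.sum_congr rfl fun U _ => Finset.sum_congr rfl fun T _ => ?_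
  simp only [disjoint_comm (a := U), Finset.union_comm U]
  split_ifs with h
  · rw [twist_of_isHomog (hF' U), twist_of_isHomog (hF T), map_smul, map_smul,
      A.antisymm _ _ _ _ (hF T) (hF' U), smul_neg, smul_neg, ← neg_smul, smul_smul, smul_smul,
      smul_smul, ← paritySign_add, neg_paritySign, ← paritySign_add, ← paritySign_add]
    congr 2
    have h1 := crossing_add_crossing d h.1
    generalize crossing d T U = x at *
    generalize crossing d U T = y at *
    generalize (∑ t ∈ T, d t) = a at *
    generalize (∑ u ∈ U, d u) = b at *
    revert x y a b
    decide
  · rfl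

/-- An even element acts on the Grassmann envelope by a derivation. -/
lemma envelopeBr_derivation {x F F' : Finset ι → G} (hx : A.IsEnvelopeHomog d 0 x)
    (hF : A.IsEnvelopeHomog d 1 F) (hF' : A.IsEnvelopeHomog d 1 F') :
    A.envelopeBr d (A.envelopeBr d F F') x =
      A.envelopeBr d (A.envelopeBr d F x) F' + A.envelopeBr d F (A.envelopeBr d F' x) := by
  classical
  -- By linearity the arguments may be taken to be monomials.
  have key : ∀ T U W, A.envelopeBr d (A.envelopeBr d (Pi.single T (F T)) (Pi.single U (F' U)))
      (Pi.single W (x W)) =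
      A.envelopeBr d (A.envelopeBr d (Pi.single T (F T)) (Pi.single W (x W))) (Pi.single U (F' U)) +
      A.envelopeBr d (Pi.single T (F T))
        (A.envelopeBr d (Pi.single U (F' U)) (Pi.single W (x W))) := by
    intro T U W
    rw [envelopeBr_single T U _ (hF' U), envelopeBr_single T W _ (hx W),
      envelopeBr_single U W _ (hx W)]
    by_cases hTU : Disjoint T U <;> by_cases hTW : Disjoint T W <;> by_cases hUW : Disjoint U W <;>
      simp only [hTU, hTW, hUW, if_true, if_false, map_zero, LinearMap.zero_apply, add_zero]
    · rw [envelopeBr_single _ _ _ (hx W), envelopeBr_single _ _ _ (hF' U),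
        envelopeBr_single _ _ _ (((hF' U).br (hx W)).smul _)]
      rw [if_pos (Finset.disjoint_union_left.2 ⟨hTW, hUW⟩),
        if_pos (Finset.disjoint_union_left.2 ⟨hTU, hUW.symm⟩),
        if_pos (Finset.disjoint_union_right.2 ⟨hTU, hTW⟩)]
      rw [show T ∪ W ∪ U = T ∪ U ∪ W by ac_rfl, ← Finset.union_assoc, ← Pi.single_add]
      congr 1
      simp only [map_smul, LinearMap.smul_apply, smul_smul, ← paritySign_add]
      rw [A.jacobi _ _ _ _ _ (hF T) (hF' U), A.antisymm _ _ _ _ (hF' U) ((hF T).br (hx W)),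
        Finset.sum_union hTU, Finset.sum_union hTW, crossing_union_left d hTU,
        crossing_union_left d hTW, crossing_union_right d hUW]
      have h1 := crossing_add_crossing d hUW
      generalize crossing d T U = e1 at *
      generalize crossing d T W = e2 at *
      generalize crossing d U W = e3 at *
      generalize crossing d W U = e4 at *
      generalize (∑ t ∈ T, d t) = a at *
      generalize (∑ t ∈ U, d t) = b at *
      generalize (∑ t ∈ W, d t) = c at *
      generalize hX : A.br (A.br (F T) (F' U)) (x W) = X
      generalize hY : A.br (A.br (F T) (x W)) (F' U) = Y
      have h2 : e2 + e3 + (a + b) * (c + 0) + (e1 + a * (b + 1)) =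
          e1 + e2 + a * (b + 1 + (c + 0)) + (e3 + b * c) := by
        ring
      have h3 : e1 + e4 + (a + c) * (b + 1) + (e2 + a * c) =
          (e1 + e2 + a * (b + 1 + (c + 0)) + (e3 + b * c)) +
            (a + 1) * (b + 1) + ((b + 1) * (a + 1 + (c + 0))) := by
        clear h2 hX hY X Y
        revert e1 e2 e3 e4 a b c
        decide
      rw [h2, h3]
      generalize e1 + e2 + a * (b + 1 + (c + 0)) + (e3 + b * c) = r
      simp only [paritySign_add]
      module
    all_goals simp [envelopeBr_single _ _ _ (hx W), envelopeBr_single _ _ _ (hF' U),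
        envelopeBr_single _ _ _ (((hF' U).br (hx W)).smul _), hTU, hTW, hUW, disjoint_comm,
        Finset.disjoint_union_right]
  have step1 : ∀ T U, A.envelopeBr d (A.envelopeBr d (Pi.single T (F T)) (Pi.single U (F' U))) x =
      A.envelopeBr d (A.envelopeBr d (Pi.single T (F T)) x) (Pi.single U (F' U)) +
      A.envelopeBr d (Pi.single T (F T)) (A.envelopeBr d (Pi.single U (F' U)) x) := by
    intro T U
    rw [← Finset.univ_sum_single x]
    simp only [map_sum, LinearMap.sum_apply, ← Finset.sum_add_distrib]
    exact Finset.sum_congr rfl fun W _ => key T U W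
  have step2 : ∀ T, A.envelopeBr d (A.envelopeBr d (Pi.single T (F T)) F') x =
      A.envelopeBr d (A.envelopeBr d (Pi.single T (F T)) x) F' +
      A.envelopeBr d (Pi.single T (F T)) (A.envelopeBr d F' x) := by
    intro T
    rw [← Finset.univ_sum_single F']
    simp only [map_sum, LinearMap.sum_apply, ← Finset.sum_add_distrib]
    exact Finset.sum_congr rfl fun U _ => step1 T U
  rw [← Finset.univ_sum_single F]
  simp only [map_sum, LinearMap.sum_apply, ← Finset.sum_add_distrib]
  exact Finset.sum_congr rfl fun T _ => step2 T

end TruncatedDGLA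

end Envelope

namespace TruncatedDGLA

section

variable {ι : Type*} [LinearOrder ι] {G : Type*} [AddCommGroup G] [Module ℝ G]
  {A : TruncatedDGLA G} [Fintype ι] {d : ι → ZMod 2}

/-- The differential is an odd derivation of the Grassmann envelope. -/
lemma Q_envelopeBr {F x : Finset ι → G} (hF : A.IsEnvelopeHomog d 1 F) (S : Finset ι) :
    A.Q (A.envelopeBr d F x S) = A.envelopeBr d (fun T => A.Q (F T)) x S -
      A.envelopeBr d F (fun T => A.Q (x T)) S := by
  simp only [envelopeBr_apply, map_sum, ← Finset.sum_sub_distrib]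
  refine Finset.sum_congr rfl fun T _ => Finset.sum_congr rfl fun U _ => ?_
  split_ifs
  · rw [map_smul, A.Q_br _ _ _ (hF T), Q_twist, map_smul, smul_smul, ← paritySign_add,
      add_right_comm, CharTwo.add_self_eq_zero, zero_add, paritySign_one]
    module
  · simp

lemma δ_envelopeBr {F F' : Finset ι → G} (hF : ∀ T, F T ∈ A.V) (hF' : ∀ T, F' T ∈ A.V)
    (S : Finset ι) : A.δ (A.envelopeBr d F F' S) = 0 := by
  simp only [envelopeBr_apply, map_sum]
  refine Finset.sum_eq_zero fun T _ => Finset.sum_eq_zero fun U _ => ?_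
  split_ifs
  · rw [map_smul, A.δ_br _ (hF T) _ (twist_mem _ (hF' U)), smul_zero]
  · simp

lemma envelopeBr_mem {F F' : Finset ι → G} (hF : ∀ T, F T ∈ A.V) (hF' : ∀ T, F' T ∈ A.V)
    (S : Finset ι) : A.envelopeBr d F F' S ∈ A.V := by
  simp only [envelopeBr_apply]
  refine Submodule.sum_mem _ fun T _ => Submodule.sum_mem _ fun U _ => ?_
  split_ifs
  · exact A.V.smul_mem _ (A.br_mem _ (hF T) _ (twist_mem _ (hF' U)))
  · exact A.V.zero_mem

lemma envelopeBr_δ_mem (F : Finset ι → G) {F' : Finset ι → G} (hF' : ∀ T, F' T ∈ A.V)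
    (S : Finset ι) : A.envelopeBr d (fun T => A.δ (F T)) F' S ∈ A.V := by
  simp only [envelopeBr_apply]
  refine Submodule.sum_mem _ fun T _ => Submodule.sum_mem _ fun U _ => ?_
  split_ifs
  · exact A.V.smul_mem _ (A.br_δ_mem _ _ (twist_mem _ (hF' U)))
  · exact A.V.zero_mem

lemma δ_envelopeBr_δ {x : Finset ι → G} (hx : A.IsEnvelopeHomog d 0 x) (S : Finset ι) :
    A.δ (A.envelopeBr d (fun T => A.δ (x T)) x S) =
      -A.envelopeBr d (fun T => A.δ (x T)) (fun T => A.δ (x T)) S := by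
  simp only [envelopeBr_apply, map_sum, ← Finset.sum_neg_distrib]
  refine Finset.sum_congr rfl fun T _ => Finset.sum_congr rfl fun U _ => ?_
  split_ifs
  · rw [map_smul, A.δ_br_δ, δ_twist, twist_δ]
    have h : ∀ c : ZMod 2, c = 0 ∨ c = 1 := by decide
    rcases h (∑ t ∈ T, d t) with h | h
    · have : A.δ (x T) = 0 := δ_eq_zero (by simpa [h] using hx T)
      simp [this]
    · simp [h]
  · simp

end

end TruncatedDGLA

/-! ### Iterated brackets -/

section Nested

variable {H : Type*} [AddCommGroup H] [Module ℝ H]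

/-- The multilinear map `(g_0, …, g_k) ↦ {…{{δ g_0, g_1}, g_2}…, g_k}`. -/
noncomputable def nestedBracket (br : H →ₗ[ℝ] H →ₗ[ℝ] H) (δ : H →ₗ[ℝ] H) :
    ∀ k : ℕ, MultilinearMap ℝ (fun _ : Fin (k + 1) => H) H
  | 0 => MultilinearMap.ofSubsingleton ℝ H H (0 : Fin 1) δ
  | k + 1 => (br.compMultilinearMap (nestedBracket br δ k)).uncurryRight

/-- The map `Q`, considered as a family of multilinear maps that vanish for more than one
argument. -/
noncomputable def linearPart (Q : H →ₗ[ℝ] H) :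
    ∀ k : ℕ, MultilinearMap ℝ (fun _ : Fin (k + 1) => H) H
  | 0 => MultilinearMap.ofSubsingleton ℝ H H (0 : Fin 1) Q
  | _ + 1 => 0

variable (br : H →ₗ[ℝ] H →ₗ[ℝ] H) (δ Q : H →ₗ[ℝ] H)

lemma nestedBracket_zero (g : Fin 1 → H) : nestedBracket br δ 0 g = δ (g 0) := rfl

lemma nestedBracket_succ (k : ℕ) (g : Fin (k + 2) → H) :
    nestedBracket br δ (k + 1) g =
      br (nestedBracket br δ k fun i => g i.castSucc) (g (Fin.last (k + 1))) := rfl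

lemma linearPart_zero (g : Fin 1 → H) : linearPart Q 0 g = Q (g 0) := rfl

lemma linearPart_succ (k : ℕ) (g : Fin (k + 2) → H) : linearPart Q (k + 1) g = 0 := rfl

/-- The brackets of the symmetric form of the `L_∞`-structure on an ungraded space: the sum of
`Q`, for a single argument, and of the symmetrized iterated brackets, weighted by the coefficients
of `- t / (exp t - 1)`. -/
noncomputable def symmetricBracket (k : ℕ) : MultilinearMap ℝ (fun _ : Fin (k + 1) => H) H :=
  linearPart Q k - bernoulliCoeff k •
    ∑ ρ : Equiv.Perm (Fin (k + 1)), (nestedBracket br δ k).domDomCongr ρ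

lemma symmetricBracket_apply (k : ℕ) (g : Fin (k + 1) → H) :
    symmetricBracket br δ Q k g = linearPart Q k g - bernoulliCoeff k •
      ∑ ρ : Equiv.Perm (Fin (k + 1)), nestedBracket br δ k (g ∘ ρ) := by
  simp only [symmetricBracket, sub_apply, smul_apply, sum_apply]
  rfl

lemma linearPart_comp_perm (k : ℕ) (g : Fin (k + 1) → H) (τ : Equiv.Perm (Fin (k + 1))) :
    linearPart Q k (g ∘ τ) = linearPart Q k g := by
  cases k with
  | zero =>
    rw [linearPart_zero, linearPart_zero, Function.comp_apply,
      Subsingleton.elim (α := Fin 1) (τ 0) 0]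
  | succ k => rfl

lemma symmetricBracket_comp_perm (k : ℕ) (g : Fin (k + 1) → H) (τ : Equiv.Perm (Fin (k + 1))) :
    symmetricBracket br δ Q k (g ∘ τ) = symmetricBracket br δ Q k g := by
  rw [symmetricBracket_apply, symmetricBracket_apply, linearPart_comp_perm]
  congr 2
  exact Equiv.sum_comp (Equiv.mulLeft τ) fun ρ => nestedBracket br δ k (g ∘ ρ)

lemma nestedBracket_const (x : H) (k : ℕ) :
    nestedBracket br δ k (fun _ => x) = (br.flip x ^ k) (δ x) := by
  induction k with
  | zero => rfl
  | succ k ih => rw [nestedBracket_succ, ih, pow_succ', Module.End.mul_apply]; rfl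

/-- `∑ i + j = k - 1, a ^ i {a ^ j (δ x), y}` for `a = {-, x}`. -/
noncomputable def insertion (x y : H) : ℕ → H
  | 0 => 0
  | k + 1 => br.flip x (insertion x y k) + br ((br.flip x ^ k) (δ x)) y

/-- The derivative of `x ↦ a ^ k (δ x)`, `a = {-, x}`, in the direction `y`. -/
lemma sum_nestedBracket_update (x y : H) (k : ℕ) :
    ∑ j, nestedBracket br δ k (Function.update (fun _ => x) j y) =
      (br.flip x ^ k) (δ y) + insertion br δ x y k := by
  induction k with
  | zero => simp [nestedBracket_zero, insertion]
  | succ k ih =>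
    rw [Fin.sum_univ_castSucc]
    have h1 : ∀ j : Fin (k + 1), nestedBracket br δ (k + 1)
        (Function.update (fun _ => x) j.castSucc y) =
        br.flip x (nestedBracket br δ k (Function.update (fun _ => x) j y)) := by
      intro j
      rw [nestedBracket_succ, Function.update_of_ne (Fin.castSucc_lt_last j).ne',
        LinearMap.flip_apply]
      congr 3
      funext i
      simp [Function.update_apply]
    have h2 : nestedBracket br δ (k + 1) (Function.update (fun _ => x) (Fin.last (k + 1)) y) =
        br ((br.flip x ^ k) (δ x)) y := by
      rw [nestedBracket_succ, Function.update_self, ← nestedBracket_const]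
      congr 3
      funext i
      rw [Function.update_of_ne (Fin.castSucc_lt_last i).ne]
    rw [Finset.sum_congr rfl fun j _ => h1 j, h2, ← map_sum, ih, map_add, insertion, pow_succ',
      Module.End.mul_apply, add_assoc]

lemma symmetricBracket_const (x : H) (k : ℕ) :
    symmetricBracket br δ Q k (fun _ => x) = linearPart Q k (fun _ => x) -
      (bernoulliCoeff k * (k + 1).factorial) • (br.flip x ^ k) (δ x) := by
  rw [symmetricBracket_apply]
  simp only [Function.comp_def, nestedBracket_const, Finset.sum_const,
    Finset.card_univ, Fintype.card_perm, Fintype.card_fin]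
  rw [← Nat.cast_smul_eq_nsmul ℝ, smul_smul]

lemma symmetricBracket_cons (x y : H) (k : ℕ) :
    symmetricBracket br δ Q k (Fin.cons y fun _ => x) =
      linearPart Q k (fun _ => y) - (bernoulliCoeff k * k.factorial) •
        ((br.flip x ^ k) (δ y) + insertion br δ x y k) := by
  have h0 : (Fin.cons y fun _ => x : Fin (k + 1) → H) = Function.update (fun _ => x) 0 y := by
    ext i
    refine Fin.cases ?_ (fun i => ?_) i
    · simp
    · simp
  rw [symmetricBracket_apply]
  congr 1
  · cases k <;> rfl
  · rw [← smul_smul, ← sum_nestedBracket_update, ← sum_perm_apply_zero]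
    congr 1
    rw [← Equiv.sum_comp (Equiv.inv (Equiv.Perm (Fin (k + 1))))]
    refine Finset.sum_congr rfl fun ρ _ => ?_
    congr 1
    ext i
    rw [h0]
    simp only [Function.comp_apply, Function.update_apply, Equiv.inv_apply]
    simp only [Equiv.Perm.inv_eq_iff_eq]

lemma insertion_sub_smul (x y y' : H) (c : ℝ) (k : ℕ) :
    insertion br δ x (y - c • y') k = insertion br δ x y k - c • insertion br δ x y' k := by
  induction k with
  | zero => simp [insertion]
  | succ k ih =>
    simp only [insertion, ih, map_sub, map_smul]
    module

lemma insertion_zero (x : H) (k : ℕ) : insertion br δ x 0 k = 0 := by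
  induction k with
  | zero => simp [insertion]
  | succ k ih => simp [insertion, ih]

/-- The generalized Jacobi identities for the brackets `symmetricBracket`, evaluated on copies of a
single element `x`. The hypotheses are the consequences of the laws of a differential graded Lie
algebra and of its degrees for an even element `x` of negative degree. -/
theorem sum_symmetricBracket {x : H}
    (hsymm : ∀ p q : ℕ, br ((br.flip x ^ p) (δ x)) ((br.flip x ^ q) (δ x)) =
      br ((br.flip x ^ q) (δ x)) ((br.flip x ^ p) (δ x)))
    (hder : ∀ p q : ℕ, br (br ((br.flip x ^ p) (δ x)) ((br.flip x ^ q) (δ x))) x =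
      br (br ((br.flip x ^ p) (δ x)) x) ((br.flip x ^ q) (δ x)) +
        br ((br.flip x ^ p) (δ x)) (br ((br.flip x ^ q) (δ x)) x))
    (hQ : ∀ k : ℕ, Q (br ((br.flip x ^ k) (δ x)) x) =
      br (Q ((br.flip x ^ k) (δ x))) x - br ((br.flip x ^ k) (δ x)) (Q x))
    (hQQ : Q (Q x) = 0) (hQδ : Q (δ x) = 0) (hδQ : δ (Q x) = 0) (hδδ : δ (δ x) = 0)
    (hδ1 : δ (br (δ x) x) = -br (δ x) (δ x))
    (hδ2 : ∀ k : ℕ, δ ((br.flip x ^ (k + 2)) (δ x)) = 0) (M : ℕ) :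
    ∑ i ∈ Finset.HasAntidiagonal.antidiagonal M,
      (((i.1 + 1).factorial : ℝ)⁻¹ * (i.2.factorial : ℝ)⁻¹) • symmetricBracket br δ Q i.2
        (Fin.cons (symmetricBracket br δ Q i.1 fun _ => x) fun _ => x) = 0 := by
  set a := br.flip x with ha
  set u := δ x with hu
  have hQau : ∀ k, Q ((a ^ k) u) = -insertion br δ x (Q x) k := by
    intro k
    induction k with
    | zero => simp [hQδ, insertion]
    | succ k ih =>
      rw [pow_succ', Module.End.mul_apply, insertion, ha, LinearMap.flip_apply, ← ha, hQ, ih, hu]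
      rw [map_neg, LinearMap.neg_apply, ha, LinearMap.flip_apply]
      abel
  -- The bracket of `l + 1` copies of `x` is `(l + 1)! * y l`.
  set y : ℕ → H := fun l => linearPart Q l (fun _ => x) - bernoulliCoeff l • (a ^ l) u with hy
  have hb0 : bernoulliCoeff 0 = 1 := by simp [bernoulliCoeff]
  have hb1 : bernoulliCoeff 1 = -(1 / 2) := by
    simp [bernoulliCoeff, bernoulli_one]
    norm_num
  have hterm : ∀ l k : ℕ, (((l + 1).factorial : ℝ)⁻¹ * (k.factorial : ℝ)⁻¹) •
      symmetricBracket br δ Q k (Fin.cons (symmetricBracket br δ Q l fun _ => x) fun _ => x) =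
      linearPart Q k (fun _ => y l) - bernoulliCoeff k • (a ^ k) (δ (y l)) -
        bernoulliCoeff k • insertion br δ x (y l) k := by
    intro l k
    have hl : (((l + 1).factorial : ℕ) : ℝ) ≠ 0 := by positivity
    have hk : ((k.factorial : ℕ) : ℝ) ≠ 0 := by positivity
    have h1 : symmetricBracket br δ Q l (fun _ => x) = ((l + 1).factorial : ℝ) • y l := by
      rw [symmetricBracket_const, hy]
      cases l with
      | zero => simp [hu]
      | succ l => simp only [linearPart_succ, zero_sub, smul_neg, smul_smul]; rw [mul_comm]
    have h2 := (symmetricBracket br δ Q k).cons_smul (fun _ => x) ((l + 1).factorial : ℝ) (y l)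
    rw [h1, h2, smul_smul, mul_right_comm, inv_mul_cancel₀ hl, one_mul, symmetricBracket_cons]
    cases k with
    | zero => simp [insertion]
    | succ k =>
      simp only [linearPart_succ, zero_sub, smul_neg, smul_smul]
      rw [mul_comm (bernoulliCoeff _), inv_mul_cancel_left₀ hk, smul_add]
      abel
  rw [Finset.sum_congr rfl fun i _ => hterm i.1 i.2]
  have hy0 : y 0 = Q x - u := by simp [hy, hb0, linearPart_zero]
  have hys : ∀ l, y (l + 1) = -(bernoulliCoeff (l + 1) • (a ^ (l + 1)) u) := by
    intro l
    simp [hy, linearPart_succ]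
  have hδ0 : δ (y 0) = 0 := by rw [hy0, map_sub, hδQ, hδδ, sub_zero]
  have hδ1' : δ (y 1) = -((1 / 2 : ℝ) • br u u) := by
    rw [hys 0, zero_add, pow_one, map_neg, map_smul, ha, LinearMap.flip_apply, hδ1, hb1]
    module
  -- Thus `y 1` is the only `y l` with a contribution of `δ`.
  have hδ2' : ∀ l, δ (y (l + 2)) = 0 := by
    intro l
    rw [hys, map_neg, map_smul, hδ2, smul_zero, neg_zero]
  cases M with
  | zero =>
    have hQ0 : Q (y 0) = 0 := by rw [hy0, map_sub, hQQ, hQδ, sub_zero]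
    simp [hδ0, insertion, linearPart_zero, hQ0]
  | succ M =>
    -- The first sum is the part of the third one that contains `Q x`, and the second one is the
    -- last term of the identity between Bernoulli numbers.
    have hA : ∑ i ∈ Finset.HasAntidiagonal.antidiagonal (M + 1),
        linearPart Q i.2 (fun _ => y i.1) =
          bernoulliCoeff (M + 1) • insertion br δ x (Q x) (M + 1) := by
      rw [Finset.Nat.sum_antidiagonal_succ']
      simp [linearPart_succ, linearPart_zero, hys, hQau]
    have hB : ∑ i ∈ Finset.HasAntidiagonal.antidiagonal (M + 1),
        bernoulliCoeff i.2 • (a ^ i.2) (δ (y i.1)) =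
          -((bernoulliCoeff M / 2) • (a ^ M) (br u u)) := by
      rw [Finset.Nat.sum_antidiagonal_succ, Finset.sum_eq_single (0, M)]
      · simp only [hδ0, map_zero, smul_zero, zero_add, hδ1', map_neg, map_smul]
        module
      · rintro ⟨l, k⟩ hlk hne
        cases l with
        | zero =>
          have : k = M := by simpa using hlk
          exact absurd (by rw [this]) hne
        | succ l => simp [hδ2']
      · simp
    have hC : ∑ i ∈ Finset.HasAntidiagonal.antidiagonal (M + 1),
        bernoulliCoeff i.2 • insertion br δ x (y i.1) i.2 =
          bernoulliCoeff (M + 1) • insertion br δ x (Q x) (M + 1) -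
          ∑ i ∈ Finset.HasAntidiagonal.antidiagonal (M + 1),
            (bernoulliCoeff i.1 * bernoulliCoeff i.2) • insertion br δ x ((a ^ i.2) u) i.1 := by
      rw [← Finset.Nat.sum_antidiagonal_swap (f := fun i =>
        (bernoulliCoeff i.1 * bernoulliCoeff i.2) • insertion br δ x ((a ^ i.2) u) i.1)]
      simp only [hy, insertion_sub_smul, smul_sub, Finset.sum_sub_distrib, smul_smul, Prod.fst_swap,
        Prod.snd_swap]
      congr 1
      rw [Finset.Nat.sum_antidiagonal_succ]
      simp [linearPart_zero, linearPart_succ, insertion_zero]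
    have hD := sum_bernoulliCoeff_smul a (fun p q => br ((a ^ p) u) ((a ^ q) u))
      (fun k l => insertion br δ x ((a ^ l) u) k) (fun p q => by
        rw [pow_succ', pow_succ']
        exact hder p q) hsymm (fun l => rfl) (fun k l => rfl) M
    rw [Finset.sum_sub_distrib, Finset.sum_sub_distrib, hA, hB, hC, ← hD]
    simp only [pow_zero, Module.End.one_apply]
    abel

end Nested

namespace TruncatedDGLA

variable {ι : Type*} [LinearOrder ι] {G : Type*} [AddCommGroup G] [Module ℝ G]
  (A : TruncatedDGLA G) [Fintype ι] (d : ι → ZMod 2)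

/-- The brackets of the symmetric form of the `L_∞`-structure, on the Grassmann envelope. -/
noncomputable def envelopeBracket (k : ℕ) :
    MultilinearMap ℝ (fun _ : Fin (k + 1) => Finset ι → G) (Finset ι → G) :=
  symmetricBracket (A.envelopeBr d) (A.δ.compLeft (Finset ι)) (A.Q.compLeft (Finset ι)) k

variable {A d}

/-- The generalized Jacobi identities on the Grassmann envelope, for an even argument. -/
theorem sum_envelopeBracket {x : Finset ι → G} (hx : A.IsEnvelopeHomog d 0 x)
    (hxV : ∀ T, x T ∈ A.V) (M : ℕ) :
    ∑ i ∈ Finset.HasAntidiagonal.antidiagonal M,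
      (((i.1 + 1).factorial : ℝ)⁻¹ * (i.2.factorial : ℝ)⁻¹) • A.envelopeBracket d i.2
        (Fin.cons (A.envelopeBracket d i.1 fun _ => x) fun _ => x) = 0 := by
  have hau : ∀ k, A.IsEnvelopeHomog d 1
      (((A.envelopeBr d).flip x ^ k) (A.δ.compLeft (Finset ι) x)) := by
    intro k
    induction k with
    | zero =>
      intro S
      have := (hx S).δ
      rwa [add_zero] at this
    | succ k ih =>
      rw [pow_succ', Module.End.mul_apply]
      have := ih.envelopeBr hx
      rwa [add_zero] at this
  have hauV : ∀ k S,
      ((A.envelopeBr d).flip x ^ (k + 1)) (A.δ.compLeft (Finset ι) x) S ∈ A.V := by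
    intro k
    induction k with
    | zero =>
      intro S
      rw [zero_add, pow_one]
      change A.envelopeBr d (fun T => A.δ (x T)) x S ∈ A.V
      exact envelopeBr_δ_mem x hxV S
    | succ k ih =>
      intro S
      rw [pow_succ', Module.End.mul_apply, LinearMap.flip_apply]
      exact envelopeBr_mem ih hxV S
  have hsymm := fun p q => envelopeBr_symm (hau p) (hau q)
  have hder := fun p q => envelopeBr_derivation hx (hau p) (hau q)
  refine sum_symmetricBracket (x := x) (A.envelopeBr d) (A.δ.compLeft (Finset ι))
    (A.Q.compLeft (Finset ι)) hsymm hder (fun k => ?_) ?_ ?_ ?_ ?_ ?_ (fun k => ?_) M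
  · exact funext fun S => Q_envelopeBr (hau k) S
  · exact funext fun S => A.Q_Q _
  · exact funext fun S => A.Q_δ _
  · exact funext fun S => A.δ_Q _
  · exact funext fun S => A.δ_δ _
  · exact funext fun S => δ_envelopeBr_δ hx S
  · rw [pow_succ', Module.End.mul_apply, LinearMap.flip_apply]
    exact funext fun S => δ_envelopeBr (hauV k) hxV S

end TruncatedDGLA

/-! ### Homogeneous arguments -/

namespace TruncatedDGLA

section

variable {G : Type*} [AddCommGroup G] [Module ℝ G] (A : TruncatedDGLA G)

/-- The component of parity `q`. -/
noncomputable def parityPart (q : ZMod 2) : G →ₗ[ℝ] G :=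
  (1 / 2 : ℝ) • (LinearMap.id + paritySign q • A.π)

/-- The brackets of the symmetric form of the `L_∞`-structure. On homogeneous arguments these are
the symmetrized iterated brackets with Koszul signs, see `koszulBracket_of_isHomog`. As the signs
depend on the parities of the arguments, these are decomposed into their parts of parity `q i`. -/
noncomputable def koszulBracket (k : ℕ) : MultilinearMap ℝ (fun _ : Fin (k + 1) => G) G :=
  linearPart A.Q k - bernoulliCoeff k • ∑ q : Fin (k + 1) → ZMod 2,
    ∑ ρ : Equiv.Perm (Fin (k + 1)), paritySign (koszulExponent q ρ) •
      ((nestedBracket A.br A.δ k).domDomCongr ρ).compLinearMap fun i => A.parityPart (q i)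

variable {A}

lemma parityPart_of_isHomog (q : ZMod 2) {p : ZMod 2} {g : G} (hg : A.IsHomog p g) :
    A.parityPart q g = if q = p then g else 0 := by
  have h : A.parityPart q g = ((1 / 2 : ℝ) * (1 + paritySign (q + p))) • g := by
    rw [parityPart, LinearMap.smul_apply, LinearMap.add_apply, LinearMap.smul_apply,
      LinearMap.id_apply, hg, paritySign_add]
    module
  have h2 : ∀ c : ZMod 2, c = 0 ∨ c = 1 := by decide
  rw [h]
  rcases h2 (q + p) with h3 | h3
  · have : q = p := by rw [← sub_eq_zero, CharTwo.sub_eq_add, h3]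
    rw [h3, if_pos this]; norm_num
  · have : q ≠ p := by rintro rfl; rw [CharTwo.add_self_eq_zero] at h3; exact zero_ne_one h3
    rw [h3, if_neg this]; norm_num

lemma parityPart_zero_add_one (g : G) : A.parityPart 0 g + A.parityPart 1 g = g := by
  simp only [parityPart, LinearMap.smul_apply, LinearMap.add_apply, LinearMap.id_apply,
    paritySign_zero, paritySign_one]
  module

lemma parityPart_mem (q : ZMod 2) {g : G} (hg : g ∈ A.V) : A.parityPart q g ∈ A.V :=
  A.V.smul_mem _ (A.V.add_mem hg (A.V.smul_mem _ (A.π_mem g hg)))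

lemma koszulBracket_of_isHomog {k : ℕ} {q : Fin (k + 1) → ZMod 2} {g : Fin (k + 1) → G}
    (hg : ∀ i, A.IsHomog (q i) (g i)) :
    A.koszulBracket k g = linearPart A.Q k g - bernoulliCoeff k •
      ∑ ρ : Equiv.Perm (Fin (k + 1)), paritySign (koszulExponent q ρ) •
        nestedBracket A.br A.δ k (g ∘ ρ) := by
  simp only [koszulBracket, sub_apply, smul_apply, sum_apply]
  congr 2
  rw [Finset.sum_eq_single q]
  · refine Finset.sum_congr rfl fun ρ _ => ?_
    congr 1
    change nestedBracket A.br A.δ k (fun i => A.parityPart (q (ρ i)) (g (ρ i))) = _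
    congr 1
    funext i
    simp [parityPart_of_isHomog _ (hg _)]
  · intro q' _ hq'
    obtain ⟨i, hi⟩ := Function.ne_iff.1 hq'
    refine Finset.sum_eq_zero fun ρ _ => ?_
    rw [MultilinearMap.compLinearMap_apply, MultilinearMap.map_coord_zero _ i, smul_zero]
    rw [parityPart_of_isHomog _ (hg i), if_neg hi]
  · simp

lemma nestedBracket_mem (k : ℕ) {g : Fin (k + 2) → G} (hg : ∀ i, g i ∈ A.V) :
    nestedBracket A.br A.δ (k + 1) g ∈ A.V := by
  induction k with
  | zero => exact A.br_δ_mem _ _ (hg _)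
  | succ k ih => exact A.br_mem _ (ih fun i => hg _) _ (hg _)

lemma isHomog_nestedBracket {k : ℕ} {q : Fin (k + 1) → ZMod 2} {g : Fin (k + 1) → G}
    (hg : ∀ i, A.IsHomog (q i) (g i)) :
    A.IsHomog (∑ i, q i + 1) (nestedBracket A.br A.δ k g) := by
  induction k with
  | zero => rw [nestedBracket_zero]; simpa using (hg 0).δ
  | succ k ih =>
    rw [nestedBracket_succ, Fin.sum_univ_castSucc, add_right_comm]
    exact (ih fun i => hg i.castSucc).br (hg _)

lemma isHomog_koszulBracket {k : ℕ} {q : Fin (k + 1) → ZMod 2} {g : Fin (k + 1) → G}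
    (hg : ∀ i, A.IsHomog (q i) (g i)) :
    A.IsHomog (∑ i, q i + 1) (A.koszulBracket k g) := by
  rw [koszulBracket_of_isHomog hg]
  refine IsHomog.sub ?_ (IsHomog.smul (IsHomog.sum fun ρ _ => IsHomog.smul ?_ _) _)
  · cases k with
    | zero => rw [linearPart_zero]; simpa using (hg 0).Q
    | succ k => exact IsHomog.zero _
  · rw [← Equiv.sum_comp ρ]
    exact isHomog_nestedBracket fun i => hg (ρ i)

lemma koszulBracket_zero (g : Fin 1 → G) : A.koszulBracket 0 g = A.Q (g 0) - A.δ (g 0) := by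
  simp only [koszulBracket, sub_apply, smul_apply, sum_apply, linearPart_zero]
  congr 1
  have hb0 : bernoulliCoeff 0 = 1 := by simp [bernoulliCoeff]
  have h1 : ∀ (q : Fin 1 → ZMod 2) (ρ : Equiv.Perm (Fin 1)), koszulExponent q ρ = 0 := by
    intro q ρ
    simp [koszulExponent, inversionSum]
  rw [hb0, one_smul]
  simp only [h1, paritySign_zero, one_smul]
  rw [← Equiv.sum_comp (Equiv.funUnique (Fin 1) (ZMod 2)).symm]
  have h2 : ∀ (a : ZMod 2) (ρ : Equiv.Perm (Fin 1)),
      ((((nestedBracket A.br A.δ 0).domDomCongr ρ).compLinearMap fun i =>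
        A.parityPart (((Equiv.funUnique (Fin 1) (ZMod 2)).symm a) i)) g) =
        A.δ (A.parityPart a (g 0)) := by
    intro a ρ
    change A.δ (A.parityPart a (g (ρ 0))) = _
    rw [Subsingleton.elim (ρ 0) 0]
  simp only [h2, Finset.sum_const]
  have h3 : (Finset.univ : Finset (ZMod 2)) = {0, 1} := by decide
  rw [h3, Finset.sum_pair (by decide)]
  simp [← map_add, parityPart_zero_add_one]

lemma koszulBracket_mem (k : ℕ) {g : Fin (k + 1) → G} (hg : ∀ i, g i ∈ A.V) :
    A.koszulBracket k g ∈ A.V := by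
  cases k with
  | zero =>
    rw [koszulBracket_zero]
    exact A.Q_sub_δ_mem _ (hg 0)
  | succ k =>
    simp only [koszulBracket, sub_apply, smul_apply, sum_apply, linearPart_succ, zero_sub]
    refine A.V.neg_mem (A.V.smul_mem _ (Submodule.sum_mem _ fun q _ =>
      Submodule.sum_mem _ fun ρ _ => A.V.smul_mem _ ?_))
    exact nestedBracket_mem k fun i => parityPart_mem _ (hg _)

end

/-! ### Evaluation on monomials of the Grassmann envelope -/

section

variable {ι : Type*} [LinearOrder ι] {d : ι → ZMod 2}

/-- The exponent of the sign that results from writing the product of the `g_a ⊗ λ_{T a}`, with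
`g_a` of parity `q a`, as a product of the `g_a` times a monomial. -/
def monomialExponent (d : ι → ZMod 2) {k : ℕ} (T : Fin k → Finset ι) (q : Fin k → ZMod 2) :
    ZMod 2 :=
  pairSum fun a b => crossing d (T a) (T b) + (∑ t ∈ T a, d t) * q b

lemma crossing_biUnion_left {k : ℕ} {T : Fin k → Finset ι}
    (hT : Pairwise fun a b => Disjoint (T a) (T b)) (U : Finset ι) :
    crossing d (Finset.univ.biUnion T) U = ∑ a, crossing d (T a) U :=
  Finset.sum_biUnion fun _ _ _ _ h => hT h

lemma pairwise_disjoint_succ {k : ℕ} {T : Fin (k + 1) → Finset ι} :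
    (Pairwise fun a b => Disjoint (T a) (T b)) ↔
      (Pairwise fun a b : Fin k => Disjoint (T a.castSucc) (T b.castSucc)) ∧
        Disjoint (Finset.univ.biUnion fun a : Fin k => T a.castSucc) (T (Fin.last k)) := by
  constructor
  · intro h
    refine ⟨fun a b hab => h fun e => hab (Fin.castSucc_injective _ e), ?_⟩
    rw [Finset.disjoint_biUnion_left]
    exact fun a _ => h (Fin.castSucc_lt_last a).ne
  · rintro ⟨h1, h2⟩ a b hab
    rw [Finset.disjoint_biUnion_left] at h2
    induction a using Fin.lastCases with
    | last =>
      induction b using Fin.lastCases with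
      | last => exact absurd rfl hab
      | cast b => exact (h2 b (Finset.mem_univ _)).symm
    | cast a =>
      induction b using Fin.lastCases with
      | last => exact h2 a (Finset.mem_univ _)
      | cast b => exact h1 fun e => hab (by rw [e])

variable {G : Type*} [AddCommGroup G] [Module ℝ G] {A : TruncatedDGLA G} [Fintype ι]

open Classical in
lemma nestedBracket_single {k : ℕ} (T : Fin (k + 1) → Finset ι) {q : Fin (k + 1) → ZMod 2}
    {g : Fin (k + 1) → G} (hg : ∀ i, A.IsHomog (q i) (g i)) :
    nestedBracket (A.envelopeBr d) (A.δ.compLeft (Finset ι)) k (fun i => Pi.single (T i) (g i)) =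
      if Pairwise fun a b => Disjoint (T a) (T b) then
        Pi.single (Finset.univ.biUnion T)
          (paritySign (monomialExponent d T q) • nestedBracket A.br A.δ k g) else 0 := by
  induction k with
  | zero =>
    have h0 : Pairwise fun a b => Disjoint (T a) (T b) :=
      fun a b hab => absurd (Subsingleton.elim (α := Fin 1) a b) hab
    rw [if_pos h0]
    have h1 : (Finset.univ.biUnion T) = T 0 := by ext; simp
    rw [h1, nestedBracket_zero, nestedBracket_zero]
    have h2 : monomialExponent d T q = 0 := by simp [monomialExponent, pairSum]
    rw [h2, paritySign_zero, one_smul]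
    exact (Pi.single_op (fun _ => A.δ) (fun _ => map_zero _) (T 0) (g 0)).symm
  | succ k ih =>
    rw [nestedBracket_succ, ih (fun i => T i.castSucc) (fun i => hg i.castSucc)]
    have hT := pairwise_disjoint_succ (T := T)
    by_cases h1 : Pairwise fun a b : Fin (k + 1) => Disjoint (T a.castSucc) (T b.castSucc)
    · rw [if_pos h1, envelopeBr_single _ _ _ (hg _)]
      by_cases h2 : Disjoint (Finset.univ.biUnion fun a : Fin (k + 1) => T a.castSucc)
          (T (Fin.last (k + 1)))
      · rw [if_pos h2, if_pos (hT.2 ⟨h1, h2⟩)]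
        have h3 : Finset.univ.biUnion T = (Finset.univ.biUnion fun a : Fin (k + 1) =>
            T a.castSucc) ∪ T (Fin.last (k + 1)) := by
          ext i
          simp [Fin.exists_fin_succ', or_comm]
        rw [h3, nestedBracket_succ]
        congr 1
        rw [map_smul, LinearMap.smul_apply, smul_smul, ← paritySign_add]
        congr 2
        rw [monomialExponent, monomialExponent, pairSum_succ (k := k + 1), crossing_biUnion_left h1,
          Finset.sum_biUnion fun _ _ _ _ h => h1 h, Finset.sum_mul, ← Finset.sum_add_distrib,
          add_comm]
      · rw [if_neg h2, if_neg fun h => h2 (hT.1 h).2]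
    · rw [if_neg h1, if_neg fun h => h1 (hT.1 h).1]
      simp

open Classical in
/-- The brackets of the Grassmann envelope of monomials of which at most one is odd. -/
lemma envelopeBracket_single {k : ℕ} (T : Fin (k + 1) → Finset ι) {q : Fin (k + 1) → ZMod 2}
    {g : Fin (k + 1) → G} (hg : ∀ i, A.IsHomog (q i) (g i))
    (hodd : ∀ a b, a ≠ b → ((∑ t ∈ T a, d t) + q a) * ((∑ t ∈ T b, d t) + q b) = 0) :
    A.envelopeBracket d k (fun i => Pi.single (T i) (g i)) =
      if Pairwise fun a b => Disjoint (T a) (T b) then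
        Pi.single (Finset.univ.biUnion T)
          (paritySign (monomialExponent d T q) • A.koszulBracket k g) else 0 := by
  have hlin : linearPart (A.Q.compLeft (Finset ι)) k (fun i => Pi.single (T i) (g i)) =
      if Pairwise fun a b => Disjoint (T a) (T b) then Pi.single (Finset.univ.biUnion T)
          (paritySign (monomialExponent d T q) • linearPart A.Q k g) else 0 := by
    cases k with
    | zero =>
      have h0 : Pairwise fun a b => Disjoint (T a) (T b) :=
        fun a b hab => absurd (Subsingleton.elim (α := Fin 1) a b) hab
      rw [if_pos h0]
      have h1 : (Finset.univ.biUnion T) = T 0 := by ext; simp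
      rw [h1, linearPart_zero, linearPart_zero]
      have h2 : monomialExponent d T q = 0 := by simp [monomialExponent, pairSum]
      rw [h2, paritySign_zero, one_smul]
      exact (Pi.single_op (fun _ => A.Q) (fun _ => map_zero _) (T 0) (g 0)).symm
    | succ k => simp [linearPart_succ]
  have hpair : ∀ ρ : Equiv.Perm (Fin (k + 1)), (Pairwise fun a b => Disjoint (T (ρ a)) (T (ρ b))) ↔
      Pairwise fun a b => Disjoint (T a) (T b) := by
    intro ρ
    refine ⟨fun h a b hab => ?_, fun h a b hab => h (ρ.injective.ne hab)⟩
    have := h (ρ.symm.injective.ne hab)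
    simpa using this
  have hnest : ∀ ρ : Equiv.Perm (Fin (k + 1)), nestedBracket (A.envelopeBr d)
      (A.δ.compLeft (Finset ι)) k ((fun i => Pi.single (T i) (g i)) ∘ ρ) =
      if Pairwise fun a b => Disjoint (T a) (T b) then Pi.single (Finset.univ.biUnion T)
        (paritySign (monomialExponent d T q) • (paritySign (koszulExponent q ρ) •
          nestedBracket A.br A.δ k (g ∘ ρ))) else 0 := by
    intro ρ
    have h := nestedBracket_single (d := d) (fun i => T (ρ i)) (fun i => hg (ρ i))
    refine h.trans ?_
    simp only [hpair ρ]
    refine if_ctx_congr Iff.rfl (fun hT => ?_) fun _ => rfl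
    have h1 : (Finset.univ.biUnion fun i => T (ρ i)) = Finset.univ.biUnion T := by
      ext i
      simp only [Finset.mem_biUnion, Finset.mem_univ, true_and]
      exact ρ.exists_congr_left.trans (by simp)
    rw [h1, smul_smul, ← paritySign_add]
    congr 3
    rw [monomialExponent, monomialExponent,
      pairSum_comp_perm (fun a b => crossing d (T a) (T b) + (∑ t ∈ T a, d t) * q b) ρ]
    congr 1
    rw [koszulExponent]
    refine Finset.sum_congr rfl fun a _ => Finset.sum_congr rfl fun b _ => ?_
    refine if_ctx_congr Iff.rfl (fun hab => ?_) fun _ => rfl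
    have hne : ρ a ≠ ρ b := ρ.injective.ne hab.1.ne
    change crossing d (T (ρ a)) (T (ρ b)) + (∑ t ∈ T (ρ a), d t) * q (ρ b) +
      (crossing d (T (ρ b)) (T (ρ a)) + (∑ t ∈ T (ρ b), d t) * q (ρ a)) = q (ρ a) * q (ρ b)
    have h2 := crossing_add_crossing d (hT hne)
    have h3 := hodd _ _ hne
    generalize crossing d (T (ρ a)) (T (ρ b)) = x at *
    generalize crossing d (T (ρ b)) (T (ρ a)) = y at *
    generalize (∑ t ∈ T (ρ a), d t) = z at *
    generalize (∑ t ∈ T (ρ b), d t) = w at *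
    generalize q (ρ a) = s at *
    generalize q (ρ b) = t at *
    revert x y z w s t
    decide
  rw [envelopeBracket, symmetricBracket_apply, hlin, Finset.sum_congr rfl fun ρ _ => hnest ρ,
    koszulBracket_of_isHomog hg]
  by_cases hT : Pairwise fun a b => Disjoint (T a) (T b)
  · simp only [if_pos hT]
    let S := LinearMap.single ℝ (fun _ : Finset ι => G) (Finset.univ.biUnion T)
    change S _ - bernoulliCoeff k • ∑ ρ, S _ = S _
    rw [← map_sum S, ← map_smul S, ← map_sub S, smul_sub, ← Finset.smul_sum,
      smul_comm (bernoulliCoeff k)]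
  · simp [if_neg hT]

end

end TruncatedDGLA

/-! ### Unshuffles -/

lemma sum_fin_split {β : Type*} [AddCommMonoid β] {m p : ℕ} (hp : p ≤ m) (F : Fin m → β) :
    ∑ c, F c = ∑ a : Fin p, F ⟨a.val, by omega⟩ + ∑ b : Fin (m - p), F ⟨p + b.val, by omega⟩ := by
  rw [← Equiv.sum_comp (finCongr (Nat.add_sub_cancel' hp)) F, Fin.sum_univ_add]
  rfl

/-- The pairs of indices of a concatenated family. -/
lemma pairSum_split {m p : ℕ} (hp : p ≤ m) (A : Fin m → Fin m → ZMod 2) :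
    pairSum A = pairSum (fun a b : Fin p => A ⟨a.val, by omega⟩ ⟨b.val, by omega⟩) +
      ∑ a : Fin p, ∑ b : Fin (m - p), A ⟨a.val, by omega⟩ ⟨p + b.val, by omega⟩ +
      pairSum (fun a b : Fin (m - p) => A ⟨p + a.val, by omega⟩ ⟨p + b.val, by omega⟩) := by
  rw [pairSum, sum_fin_split hp]
  simp only [sum_fin_split hp (fun b => if _ < b then _ else _), Finset.sum_add_distrib, pairSum]
  have h1 : ∀ (a : Fin p) (b : Fin (m - p)),
      (⟨a.val, by omega⟩ : Fin m) < ⟨p + b.val, by omega⟩ := by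
    intro a b
    simp only [Fin.mk_lt_mk]
    omega
  have h2 : ∀ (b : Fin (m - p)) (a : Fin p),
      ¬ (⟨p + b.val, by omega⟩ : Fin m) < ⟨a.val, by omega⟩ := by
    intro b a
    simp only [Fin.mk_lt_mk]
    omega
  simp only [h1, h2, if_true, if_false, Finset.sum_const_zero, zero_add, Fin.mk_lt_mk,
    add_lt_add_iff_left, Fin.val_fin_lt]

open Classical in
/-- Unshuffles correspond to pairs of strictly monotone maps with complementary images. -/
lemma sum_unshuffle {β : Type*} [AddCommMonoid β] {m p : ℕ} (hp : p ≤ m)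
    (K : (Fin p → Fin m) → (Fin (m - p) → Fin m) → β) :
    ∑ f : Fin p → Fin m, ∑ g : Fin (m - p) → Fin m,
      (if StrictMono f ∧ StrictMono g ∧ ∀ a b, f a ≠ g b then K f g else 0) =
    ∑ σ : Equiv.Perm (Fin m), if IsUnshuffle p σ then
      K (fun a => σ ⟨a.val, by omega⟩) (fun b => σ ⟨p + b.val, by omega⟩) else 0 := by
  rw [← Fintype.sum_prod_type', ← Finset.sum_filter, ← Finset.sum_filter]
  symm
  refine Finset.sum_nbij (fun σ => (fun a => σ ⟨a.val, by omega⟩, fun b => σ ⟨p + b.val, by omega⟩))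
    ?_ ?_ ?_ (fun _ _ => rfl)
  · intro σ hσ
    rw [Finset.mem_filter] at hσ ⊢
    have hσ := hσ.2
    refine ⟨Finset.mem_univ _, fun a b hab => hσ _ _ ?_ (Or.inl b.2),
      fun a b hab => hσ _ _ ?_ (Or.inr ?_),
      fun a b h => ?_⟩
    · exact hab
    · simpa using hab
    · simp
    · have := congrArg Fin.val (σ.injective h)
      simp at this
      omega
  · intro σ _ τ _ h
    simp only [Prod.mk.injEq] at h
    ext c
    by_cases hc : c.val < p
    · exact congrArg Fin.val (congrFun h.1 ⟨c.val, hc⟩)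
    · have := congrFun h.2 ⟨c.val - p, by omega⟩
      simp only [show p + (c.val - p) = c.val by omega] at this
      exact congrArg Fin.val this
  · rintro ⟨f, g⟩ hfg
    simp only [Finset.coe_filter, Finset.mem_univ, true_and, Set.mem_ofPred_eq] at hfg
    obtain ⟨hf, hg, hd⟩ := hfg
    let h : Fin m → Fin m := fun c => if hc : c.val < p then f ⟨c.val, hc⟩ else
      g ⟨c.val - p, by omega⟩
    have hinj : Function.Injective h := by
      intro a b hab
      simp only [h] at hab
      split_ifs at hab with h1 h2 h2
      · have := congrArg Fin.val (hf.injective hab)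
        exact Fin.ext this
      · exact absurd hab (hd _ _)
      · exact absurd hab.symm (hd _ _)
      · have := congrArg Fin.val (hg.injective hab)
        simp at this
        exact Fin.ext (by omega)
    let σ : Equiv.Perm (Fin m) := Equiv.ofBijective h (Finite.injective_iff_bijective.1 hinj)
    have h1 : (fun a : Fin p => σ ⟨a.val, by omega⟩) = f := by
      funext a
      simp [σ, h]
    have h2 : (fun b : Fin (m - p) => σ ⟨p + b.val, by omega⟩) = g := by
      funext b
      simp [σ, h]
    refine ⟨σ, ?_, Prod.ext h1 h2⟩
    simp only [Finset.coe_filter, Finset.mem_univ, true_and, Set.mem_ofPred_eq]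
    rintro a b hab (hb | ha)
    · have ha : a.val < p := lt_trans hab hb
      have := hf (show (⟨a.val, ha⟩ : Fin p) < ⟨b.val, hb⟩ from hab)
      simpa [σ, h, ha, hb] using this
    · have hb : p ≤ b.val := ha.trans hab.le
      have := hg (show (⟨a.val - p, by omega⟩ : Fin (m - p)) < ⟨b.val - p, by omega⟩ from by
        simp only [Fin.mk_lt_mk]
        have : a.val < b.val := hab
        omega)
      simpa [σ, h, not_lt.2 ha, not_lt.2 hb] using this

/-! ### The generalized Jacobi identities with Koszul signs -/

namespace TruncatedDGLA

variable {G : Type*} [AddCommGroup G] [Module ℝ G] {A : TruncatedDGLA G} {m : ℕ}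
  {d : Fin m → ZMod 2}

/-- The sum of the exponents in the signs of `λ_i λ_j` and of `(-1) ^ (d i * d j)`. -/
def pairExponent (d : Fin m → ZMod 2) (i j : Fin m) : ZMod 2 :=
  (if j < i then d i * d j else 0) + d i * d j

lemma pairSum_pairExponent_perm (σ : Equiv.Perm (Fin m)) :
    pairSum (fun a b => pairExponent d (σ a) (σ b)) =
      koszulExponent d σ + pairSum (fun a b => d a * d b) := by
  simp only [pairExponent]
  rw [pairSum_add (fun a b => if σ b < σ a then d (σ a) * d (σ b) else 0)
    (fun a b => d (σ a) * d (σ b)), pairSum_comp_perm (fun a b => d a * d b) σ]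
  have h1 : inversionSum (fun a b => d a * d b + d b * d a) σ = 0 := by
    refine Finset.sum_eq_zero fun a _ => Finset.sum_eq_zero fun b _ => ?_
    change (if _ then d (σ a) * d (σ b) + d (σ b) * d (σ a) else 0) = 0
    rw [mul_comm (d (σ b)), CharTwo.add_self_eq_zero, ite_self]
  rw [h1, add_zero]
  congr 1
  rw [pairSum, koszulExponent, inversionSum]
  refine Finset.sum_congr rfl fun a _ => Finset.sum_congr rfl fun b _ => ?_
  rw [ite_and]

lemma crossing_biUnion_singleton {k : ℕ} {f : Fin k → Fin m} (hf : Function.Injective f)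
    (j : Fin m) : crossing d (Finset.univ.biUnion fun a => {f a}) {j} =
      ∑ a, if j < f a then d (f a) * d j else 0 := by
  rw [crossing, Finset.sum_biUnion]
  · simp
  · intro a _ b _ hab
    simpa using hf.ne hab

lemma sum_biUnion_singleton {k : ℕ} {f : Fin k → Fin m} (hf : Function.Injective f) :
    ∑ t ∈ Finset.univ.biUnion fun a => {f a}, d t = ∑ a, d (f a) := by
  rw [Finset.sum_biUnion]
  · simp
  · intro a _ b _ hab
    simpa using hf.ne hab

lemma pairwise_disjoint_singleton {k : ℕ} {f : Fin k → Fin m} :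
    (Pairwise fun a b => Disjoint ({f a} : Finset (Fin m)) {f b}) ↔ Function.Injective f := by
  simp only [Finset.disjoint_singleton]
  exact Function.injective_iff_pairwise_ne.symm

/-- The element `∑ i, e i ⊗ λ_i` of the Grassmann envelope. It is even if the variable `λ_i` has the
parity of `e i`. -/
noncomputable def genericElement (e : Fin m → G) : Finset (Fin m) → G := ∑ i, Pi.single {i} (e i)

variable {e : Fin m → G}

lemma genericElement_isEnvelopeHomog (he : ∀ i, A.IsHomog (d i) (e i)) :
    A.IsEnvelopeHomog d 0 (genericElement e) := by
  intro S
  rw [genericElement, Finset.sum_apply]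
  refine IsHomog.sum fun i _ => ?_
  by_cases h : S = {i}
  · subst h
    simpa using he i
  · rw [Pi.single_eq_of_ne h]
    exact IsHomog.zero _

lemma genericElement_mem {V : Submodule ℝ G} (he : ∀ i, e i ∈ V) (S : Finset (Fin m)) :
    genericElement e S ∈ V := by
  rw [genericElement, Finset.sum_apply]
  refine Submodule.sum_mem _ fun i _ => ?_
  by_cases h : S = {i}
  · subst h
    simpa using he i
  · rw [Pi.single_eq_of_ne h]
    exact V.zero_mem

open Classical in
lemma envelopeBracket_singleton (he : ∀ i, A.IsHomog (d i) (e i)) {k : ℕ}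
    (f : Fin (k + 1) → Fin m) :
    A.envelopeBracket d k (fun a => Pi.single {f a} (e (f a))) =
      if Function.Injective f then Pi.single (Finset.univ.biUnion fun a => {f a})
        (paritySign (pairSum fun a b => pairExponent d (f a) (f b)) •
          A.koszulBracket k fun a => e (f a)) else 0 := by
  have h := envelopeBracket_single (d := d) (fun a => {f a}) (fun a => he (f a)) (fun a b _ => by
    simp [CharTwo.add_self_eq_zero])
  rw [h]
  refine if_ctx_congr pairwise_disjoint_singleton (fun _ => ?_) fun _ => rfl
  congr 3
  simp [monomialExponent, crossing, pairExponent]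

open Classical in
lemma factorial_inv_smul_envelopeBracket (he : ∀ i, A.IsHomog (d i) (e i)) (k : ℕ) :
    ((k + 1).factorial : ℝ)⁻¹ • A.envelopeBracket d k (fun _ => genericElement e) =
      ∑ f : Fin (k + 1) → Fin m, if StrictMono f then
        Pi.single (Finset.univ.biUnion fun a => {f a})
          (paritySign (pairSum fun a b => pairExponent d (f a) (f b)) •
            A.koszulBracket k fun a => e (f a)) else 0 := by
  have h1 : A.envelopeBracket d k (fun _ => genericElement e) =
      ∑ f : Fin (k + 1) → Fin m,
        A.envelopeBracket d k (fun a => Pi.single {f a} (e (f a))) :=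
    (A.envelopeBracket d k).map_sum fun (_ : Fin (k + 1)) (i : Fin m) =>
      (Pi.single {i} (e i) : Finset (Fin m) → G)
  rw [h1, sum_eq_factorial_smul_sum_strictMono, smul_smul, inv_mul_cancel₀ (by positivity),
    one_smul]
  · refine Finset.sum_congr rfl fun f _ => ?_
    refine if_ctx_congr Iff.rfl (fun hf => ?_) fun _ => rfl
    rw [envelopeBracket_singleton he, if_pos hf.injective]
  · intro f τ
    exact symmetricBracket_comp_perm _ _ _ k
      (fun a => (Pi.single {f a} (e (f a)) : Finset (Fin m) → G)) τ
  · intro f hf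
    rw [envelopeBracket_singleton he, if_neg hf]

open Classical in
lemma envelopeBracket_cons_singleton (he : ∀ i, A.IsHomog (d i) (e i)) {k : ℕ} (U : Finset (Fin m))
    {q : ZMod 2} {y : G} (hy : A.IsHomog q y) (g : Fin k → Fin m) :
    A.envelopeBracket d k (Fin.cons (Pi.single U y) fun b => Pi.single {g b} (e (g b))) =
      if Function.Injective g ∧ (∀ b, g b ∉ U) then
        Pi.single (U ∪ Finset.univ.biUnion fun b => {g b})
          (paritySign (∑ b, (crossing d U {g b} + (∑ t ∈ U, d t) * d (g b)) +
              pairSum fun a b => pairExponent d (g a) (g b)) •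
            A.koszulBracket k (Fin.cons y fun b => e (g b))) else 0 := by
  let T : Fin (k + 1) → Finset (Fin m) := Fin.cons U fun b => {g b}
  let r : Fin (k + 1) → ZMod 2 := Fin.cons q fun b => d (g b)
  let z : Fin (k + 1) → G := Fin.cons y fun b => e (g b)
  have hz : ∀ i, A.IsHomog (r i) (z i) := by
    intro i
    refine Fin.cases ?_ (fun b => ?_) i
    · exact hy
    · exact he _
  have hodd : ∀ b : Fin k, (∑ t ∈ T b.succ, d t) + r b.succ = 0 := by
    intro b
    simp [T, r, CharTwo.add_self_eq_zero]
  have h := envelopeBracket_single (d := d) T hz (fun a b hab => by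
    induction a using Fin.cases with
    | zero =>
      induction b using Fin.cases with
      | zero => exact absurd rfl hab
      | succ b => rw [hodd, mul_zero]
    | succ a => rw [hodd, zero_mul])
  have hTz : (Fin.cons (Pi.single U y) fun b => Pi.single {g b} (e (g b)) :
      Fin (k + 1) → Finset (Fin m) → G) = fun i => Pi.single (T i) (z i) := by
    funext i
    refine Fin.cases ?_ (fun b => ?_) i <;> rfl
  rw [hTz, h]
  have hpair : (Pairwise fun a b => Disjoint (T a) (T b)) ↔
      Function.Injective g ∧ ∀ b, g b ∉ U := by
    rw [← pairwise_disjoint_singleton]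
    constructor
    · intro h
      refine ⟨fun a b hab => h ((Fin.succ_injective _).ne hab), fun b => ?_⟩
      exact Finset.disjoint_singleton_right.1 (h (Fin.succ_ne_zero b).symm)
    · rintro ⟨h1, h2⟩ a b hab
      induction a using Fin.cases with
      | zero =>
        induction b using Fin.cases with
        | zero => exact absurd rfl hab
        | succ b => exact Finset.disjoint_singleton_right.2 (h2 b)
      | succ a =>
        induction b using Fin.cases with
        | zero => exact (Finset.disjoint_singleton_right.2 (h2 a)).symm
        | succ b => exact h1 fun hab' => hab (congrArg Fin.succ hab')
  refine if_ctx_congr hpair (fun _ => ?_) fun _ => rfl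
  have hU : Finset.univ.biUnion T = U ∪ Finset.univ.biUnion fun b => {g b} := by
    ext i
    simp [T, Fin.exists_fin_succ]
  rw [hU, monomialExponent, pairSum_cons]
  congr 4
  simp [T, r, crossing, pairExponent]

open Classical in
lemma factorial_inv_smul_envelopeBracket_cons (he : ∀ i, A.IsHomog (d i) (e i)) (k : ℕ)
    (U : Finset (Fin m)) {q : ZMod 2} {y : G} (hy : A.IsHomog q y) :
    (k.factorial : ℝ)⁻¹ • A.envelopeBracket d k (Fin.cons
        (Pi.single U y) fun _ => genericElement e) =
      ∑ g : Fin k → Fin m, if StrictMono g then A.envelopeBracket d k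
        (Fin.cons (Pi.single U y) fun b => Pi.single {g b} (e (g b))) else 0 := by
  have h1 : A.envelopeBracket d k (Fin.cons (Pi.single U y) fun _ => genericElement e) =
      ∑ g : Fin k → Fin m, A.envelopeBracket d k
        (Fin.cons (Pi.single U y) fun b => Pi.single {g b} (e (g b))) :=
    ((A.envelopeBracket d k).curryLeft (Pi.single U y)).map_sum fun (_ : Fin k) (i : Fin m) =>
      (Pi.single {i} (e i) : Finset (Fin m) → G)
  rw [h1, sum_eq_factorial_smul_sum_strictMono, smul_smul, inv_mul_cancel₀ (by positivity),
    one_smul]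
  · intro g τ
    refine Eq.trans ?_ (symmetricBracket_comp_perm _ _ _ k (Fin.cons (Pi.single U y) fun b =>
      (Pi.single {g b} (e (g b)) : Finset (Fin m) → G)) (Equiv.Perm.decomposeFin.symm (0, τ)))
    rw [envelopeBracket]
    congr 1
    funext i
    refine Fin.cases ?_ (fun b => ?_) i
    · simp
    · simp [Equiv.Perm.decomposeFin_symm_apply_succ]
  · intro g hg
    rw [envelopeBracket_cons_singleton he U hy, if_neg fun h => hg h.1]

/-- The coefficient of the product of all variables in a term of the generalized Jacobi
identities. -/
lemma envelopeBracket_cons_apply_univ (he : ∀ i, A.IsHomog (d i) (e i)) {p : ℕ} (hp : p + 1 ≤ m) :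
    ((((p + 1).factorial : ℝ)⁻¹ * ((m - (p + 1)).factorial : ℝ)⁻¹) •
      A.envelopeBracket d (m - (p + 1)) (Fin.cons
        (A.envelopeBracket d p fun _ => genericElement e) fun _ => genericElement e)) Finset.univ =
    paritySign (pairSum fun a b => d a * d b) • ∑ σ : Equiv.Perm (Fin m),
      open Classical in if IsUnshuffle (p + 1) σ then
      paritySign (koszulExponent d σ) • A.koszulBracket (m - (p + 1))
        (Fin.cons (A.koszulBracket p fun a : Fin (p + 1) => e (σ ⟨a.val, by omega⟩))
          fun b : Fin (m - (p + 1)) => e (σ ⟨p + 1 + b.val, by omega⟩))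
      else 0 := by
  classical
  set k := m - (p + 1) with hk
  -- `Y f` is the coefficient of `∏ a, λ_{f a}` in the inner bracket.
  let Y : (Fin (p + 1) → Fin m) → G := fun f =>
    paritySign (pairSum fun a b => pairExponent d (f a) (f b)) • A.koszulBracket p fun a => e (f a)
  have hY : ∀ f, A.IsHomog (∑ a, d (f a) + 1) (Y f) := fun f =>
    (isHomog_koszulBracket fun a => he (f a)).smul _
  have h1 : (((p + 1).factorial : ℝ)⁻¹ * (k.factorial : ℝ)⁻¹) •
      A.envelopeBracket d k (Fin.cons
        (A.envelopeBracket d p fun _ => genericElement e) fun _ => genericElement e) =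
      ∑ f : Fin (p + 1) → Fin m, if StrictMono f then (k.factorial : ℝ)⁻¹ • A.envelopeBracket d k
        (Fin.cons (Pi.single (Finset.univ.biUnion fun a => {f a}) (Y f))
          fun _ => genericElement e) else 0 := by
    let Φ : (Finset (Fin m) → G) →ₗ[ℝ] (Finset (Fin m) → G) :=
      { toFun := fun y => A.envelopeBracket d k (Fin.cons y fun _ => genericElement e)
        map_add' := fun y y' => (A.envelopeBracket d k).cons_add _ y y'
        map_smul' := fun c y => (A.envelopeBracket d k).cons_smul _ c y }
    change (_ * _) • Φ _ = ∑ f : Fin (p + 1) → Fin m, if StrictMono f then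
      (k.factorial : ℝ)⁻¹ • Φ _ else 0
    rw [mul_comm, ← smul_smul, ← map_smul Φ, factorial_inv_smul_envelopeBracket he, map_sum,
      Finset.smul_sum]
    refine Finset.sum_congr rfl fun f _ => ?_
    split_ifs
    · rfl
    · simp
  -- `K f g` is the contribution of the variables with indices in the images of `f` and `g` to the
  -- inner product and to the other arguments of the outer one.
  let K : (Fin (p + 1) → Fin m) → (Fin k → Fin m) → G := fun f g =>
    paritySign (pairSum (fun a b => pairExponent d (f a) (f b)) +
      ∑ a, ∑ b, pairExponent d (f a) (g b) + pairSum (fun a b => pairExponent d (g a) (g b))) •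
      A.koszulBracket k (Fin.cons (A.koszulBracket p fun a => e (f a)) fun b => e (g b))
  have h2 : ∀ f : Fin (p + 1) → Fin m, StrictMono f → ∀ g : Fin k → Fin m, StrictMono g →
      A.envelopeBracket d k (Fin.cons (Pi.single (Finset.univ.biUnion fun a => {f a}) (Y f))
        fun b => Pi.single {g b} (e (g b))) Finset.univ =
      if ∀ a b, f a ≠ g b then K f g else 0 := by
    intro f hf g hg
    rw [envelopeBracket_cons_singleton he _ (hY f)]
    by_cases hfg : ∀ a b, f a ≠ g b
    · rw [if_pos hfg, if_pos]
      · have hu : (Finset.univ.biUnion fun a => {f a}) ∪ (Finset.univ.biUnion fun b => {g b}) =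
            (Finset.univ : Finset (Fin m)) := by
          apply Finset.eq_univ_of_card
          rw [Finset.biUnion_singleton, Finset.biUnion_singleton, Finset.card_union_of_disjoint,
            Finset.card_image_of_injective _ hf.injective,
            Finset.card_image_of_injective _ hg.injective]
          · simp only [Finset.card_univ, Fintype.card_fin]
            omega
          · rw [Finset.disjoint_left]
            intro i hi hi'
            rw [Finset.mem_image] at hi hi'
            obtain ⟨a, _, rfl⟩ := hi
            obtain ⟨b, _, hb⟩ := hi'
            exact hfg a b hb.symm
        rw [hu, Pi.single_eq_same]
        simp only [Y, K]
        have h3 := (A.koszulBracket k).cons_smul (fun b => e (g b))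
          (paritySign (pairSum fun a b => pairExponent d (f a) (f b)))
          (A.koszulBracket p fun a => e (f a))
        rw [h3, smul_smul, ← paritySign_add]
        congr 2
        have h4 : ∑ b, (crossing d (Finset.univ.biUnion fun a => {f a}) {g b} +
            (∑ t ∈ Finset.univ.biUnion fun a => {f a}, d t) * d (g b)) =
            ∑ a, ∑ b, pairExponent d (f a) (g b) := by
          rw [Finset.sum_comm]
          refine Finset.sum_congr rfl fun b _ => ?_
          rw [crossing_biUnion_singleton hf.injective, sum_biUnion_singleton hf.injective,
            Finset.sum_mul, ← Finset.sum_add_distrib]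
          rfl
        rw [h4]
        ring
      · refine ⟨hg.injective, fun b hb => ?_⟩
        rw [Finset.biUnion_singleton, Finset.mem_image] at hb
        obtain ⟨a, _, ha⟩ := hb
        exact hfg a b ha
    · rw [if_neg hfg, if_neg]
      · rfl
      · rintro ⟨_, h⟩
        refine hfg fun a b hab => h b ?_
        rw [Finset.biUnion_singleton, ← hab]
        exact Finset.mem_image_of_mem _ (Finset.mem_univ a)
  rw [h1, Finset.sum_apply]
  have h5 : ∀ f : Fin (p + 1) → Fin m, (if StrictMono f then (k.factorial : ℝ)⁻¹ •
      A.envelopeBracket d k (Fin.cons (Pi.single (Finset.univ.biUnion fun a => {f a}) (Y f))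
          fun _ => genericElement e) else 0) Finset.univ =
      ∑ g : Fin k → Fin m, if StrictMono f ∧ StrictMono g ∧ ∀ a b, f a ≠ g b then K f g else 0 := by
    intro f
    by_cases hf : StrictMono f
    · rw [if_pos hf, factorial_inv_smul_envelopeBracket_cons he k _ (hY f), Finset.sum_apply]
      refine Finset.sum_congr rfl fun g _ => ?_
      by_cases hg : StrictMono g
      · rw [if_pos hg, h2 f hf g hg]
        simp [hf, hg]
      · rw [if_neg hg, if_neg fun h => hg h.2.1]
        rfl
    · simp [hf]
  rw [Finset.sum_congr rfl fun f _ => h5 f, sum_unshuffle hp K, Finset.smul_sum]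
  refine Finset.sum_congr rfl fun σ _ => ?_
  split_ifs
  · simp only [K]
    have h6 := pairSum_split hp fun a b => pairExponent d (σ a) (σ b)
    rw [pairSum_pairExponent_perm] at h6
    rw [← h6, smul_smul, ← paritySign_add, add_comm]
  · rw [smul_zero]

open Classical in
/-- The generalized Jacobi identities for `koszulBracket`. -/
theorem sum_koszulBracket (he : ∀ i, A.IsHomog (d i) (e i)) (heV : ∀ i, e i ∈ A.V) :
    ∑ p : Fin m, ∑ σ : Equiv.Perm (Fin m), (if IsUnshuffle (p.val + 1) σ then
      paritySign (koszulExponent d σ) • A.koszulBracket (m - (p.val + 1))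
        (Fin.cons (A.koszulBracket p.val fun a : Fin (p.val + 1) => e (σ ⟨a.val, by omega⟩))
          fun b : Fin (m - (p.val + 1)) => e (σ ⟨p.val + 1 + b.val, by omega⟩))
      else 0) = 0 := by
  cases m with
  | zero => simp
  | succ M =>
    have h := sum_envelopeBracket (genericElement_isEnvelopeHomog he) (genericElement_mem heV) M
    let F : ℕ → ℕ → Finset (Fin (M + 1)) → G := fun l k =>
      (((l + 1).factorial : ℝ)⁻¹ * (k.factorial : ℝ)⁻¹) • A.envelopeBracket d k
        (Fin.cons (A.envelopeBracket d l fun _ => genericElement e) fun _ => genericElement e)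
    have h1 : ∑ p : Fin (M + 1), F p (M + 1 - (p + 1)) Finset.univ = 0 := by
      have h2 : ∑ p : Fin (M + 1), F p (M + 1 - (p + 1)) = 0 := by
        rw [← h, Finset.Nat.sum_antidiagonal_eq_sum_range_succ F, Finset.sum_range]
        simp only [Nat.add_sub_add_right]
      rw [← Finset.sum_apply, h2]
      rfl
    have h3 : ∀ p : Fin (M + 1), F p (M + 1 - (p + 1)) Finset.univ = _ :=
      fun p => envelopeBracket_cons_apply_univ he p.2
    rw [Finset.sum_congr rfl fun p _ => h3 p, ← Finset.smul_sum] at h1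
    have h4 : paritySign (pairSum fun a b => d a * d b) ≠ 0 := fun h0 => by
      have := paritySign_mul_self (pairSum fun a b => d a * d b)
      rw [h0, zero_mul] at this
      exact zero_ne_one this
    exact (smul_eq_zero.1 h1).resolve_left h4

/-- Permuting homogeneous arguments of `koszulBracket` produces the Koszul sign. -/
lemma koszulBracket_comp_perm {k : ℕ} {q : Fin (k + 1) → ZMod 2} {g : Fin (k + 1) → G}
    (hg : ∀ i, A.IsHomog (q i) (g i)) (τ : Equiv.Perm (Fin (k + 1))) :
    A.koszulBracket k g = paritySign (koszulExponent q τ) • A.koszulBracket k (g ∘ τ) := by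
  classical
  have h1 := envelopeBracket_singleton (d := q) hg (fun i => i)
  have h2 := envelopeBracket_singleton (d := q) hg τ
  have h3 : A.envelopeBracket q k (fun a => Pi.single {τ a} (g (τ a))) =
      A.envelopeBracket q k (fun a => Pi.single {a} (g a)) :=
    symmetricBracket_comp_perm _ _ _ k
      (fun a => (Pi.single {a} (g a) : Finset (Fin (k + 1)) → G)) τ
  rw [if_pos (show Function.Injective fun i : Fin (k + 1) => i from fun _ _ h => h)] at h1
  rw [if_pos τ.injective, h3, h1] at h2
  have hu : ∀ τ : Equiv.Perm (Fin (k + 1)), (Finset.univ.biUnion fun a => {τ a}) =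
      (Finset.univ : Finset (Fin (k + 1))) := by
    intro τ
    rw [Finset.biUnion_singleton, Finset.image_univ_of_surjective τ.surjective]
  have h4 := congrFun h2 Finset.univ
  have hu1 := hu 1
  simp only [Equiv.Perm.one_apply] at hu1
  rw [hu, hu1, Pi.single_eq_same, Pi.single_eq_same] at h4
  have h5 := pairSum_pairExponent_perm (d := q) 1
  have h6 : koszulExponent q 1 = 0 := by
    rw [koszulExponent, inversionSum]
    refine Finset.sum_eq_zero fun a _ => Finset.sum_eq_zero fun b _ => ?_
    exact if_neg fun h => h.1.asymm h.2
  rw [h6, zero_add] at h5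
  simp only [Equiv.Perm.one_apply] at h5
  rw [h5, pairSum_pairExponent_perm] at h4
  have h7 := congrArg (fun v => paritySign (pairSum fun a b => q a * q b) • v) h4
  simp only [smul_smul, ← paritySign_add, CharTwo.add_self_eq_zero, paritySign_zero, one_smul] at h7
  rw [h7]
  congr 2
  rw [add_left_comm, CharTwo.add_self_eq_zero, add_zero]

end TruncatedDGLA

/-! ### The differential graded Lie algebra of a symplectic Lie `n`-algebroid -/

section

variable {d : ℕ} {M : Type u} [TopologicalSpace M]
  [ChartedSpace (EuclideanSpace ℝ (Fin d)) M] [IsManifold (𝓡 d) ∞ M]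
  (𝓜 : GradedManifold.{u, v} d M)

namespace GradedManifold

/-- The decomposition of global functions by degree. -/
noncomputable def decomposition : 𝓜.O ⊤ ≃ₗ[ℝ] DirectSum ℕ fun i => 𝓜.gr ⊤ i :=
  (LinearEquiv.ofBijective (DirectSum.coeLinearMap (𝓜.gr ⊤)) (𝓜.isInternal ⊤)).symm

/-- The component of degree `i`. -/
noncomputable def component (i : ℕ) : 𝓜.O ⊤ →ₗ[ℝ] 𝓜.O ⊤ :=
  (𝓜.gr ⊤ i).subtype ∘ₗ DirectSum.component ℝ ℕ (fun i => 𝓜.gr ⊤ i) i ∘ₗ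
    𝓜.decomposition.toLinearMap

/-- The operator `(-1) ^ (i + n)` on functions of degree `i`. -/
noncomputable def parityOperator (n : ℕ) : 𝓜.O ⊤ →ₗ[ℝ] 𝓜.O ⊤ :=
  DirectSum.toModule ℝ ℕ (𝓜.O ⊤)
    (fun i => paritySign ((i : ZMod 2) + (n : ZMod 2)) • (𝓜.gr ⊤ i).subtype) ∘ₗ
    𝓜.decomposition.toLinearMap

variable {𝓜}

lemma decomposition_of_mem {i : ℕ} {g : 𝓜.O ⊤} (hg : g ∈ 𝓜.gr ⊤ i) :
    𝓜.decomposition g = DirectSum.lof ℝ ℕ (fun i => 𝓜.gr ⊤ i) i ⟨g, hg⟩ := by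
  rw [decomposition, LinearEquiv.symm_apply_eq]
  exact (DirectSum.coeLinearMap_lof (𝓜.gr ⊤) i ⟨g, hg⟩).symm

lemma component_of_mem (i : ℕ) {j : ℕ} {g : 𝓜.O ⊤} (hg : g ∈ 𝓜.gr ⊤ j) :
    𝓜.component i g = if i = j then g else 0 := by
  simp only [component, LinearMap.comp_apply, LinearEquiv.coe_coe, decomposition_of_mem hg]
  split_ifs with h
  · subst h
    rw [DirectSum.component.lof_self]
    rfl
  · rw [DirectSum.component.of, dif_neg (Ne.symm h), map_zero]

lemma parityOperator_of_mem (n : ℕ) {j : ℕ} {g : 𝓜.O ⊤} (hg : g ∈ 𝓜.gr ⊤ j) :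
    𝓜.parityOperator n g = paritySign ((j : ZMod 2) + (n : ZMod 2)) • g := by
  simp only [parityOperator, LinearMap.comp_apply, LinearEquiv.coe_coe, decomposition_of_mem hg,
    DirectSum.toModule_lof]
  rfl

lemma homogeneous_induction {P : 𝓜.O ⊤ → Prop} (h : ∀ i, ∀ g ∈ 𝓜.gr ⊤ i, P g)
    (hadd : ∀ g g', P g → P g' → P (g + g')) (g : 𝓜.O ⊤) : P g := by
  have hg : g ∈ ⨆ i, 𝓜.gr ⊤ i := by
    rw [(𝓜.isInternal ⊤).submodule_iSup_eq_top]
    trivial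
  exact Submodule.iSup_induction _ (motive := P) hg h (h 0 0 (Submodule.zero_mem _)) hadd

lemma parityOperator_parityOperator (n : ℕ) (g : 𝓜.O ⊤) :
    𝓜.parityOperator n (𝓜.parityOperator n g) = g := by
  induction g using homogeneous_induction with
  | h i g hg =>
    rw [parityOperator_of_mem n hg, map_smul, parityOperator_of_mem n hg, smul_smul,
      paritySign_mul_self, one_smul]
  | hadd g g' h h' => rw [map_add, map_add, h, h']

/-- An element of parity `p` is a sum of homogeneous elements whose degrees have this parity. -/
lemma parity_induction (n : ℕ) {p : ZMod 2} {P : 𝓜.O ⊤ → Prop}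
    (h : ∀ i : ℕ, (i : ZMod 2) + (n : ZMod 2) = p → ∀ g ∈ 𝓜.gr ⊤ i, P g) (h0 : P 0)
    (hadd : ∀ g g', P g → P g' → P (g + g')) (g : 𝓜.O ⊤)
    (hg : 𝓜.parityOperator n g = paritySign p • g) : P g := by
  -- The operator `(1 + (-1) ^ p π) / 2` is the projection onto the elements of parity `p`.
  have key : ∀ w : 𝓜.O ⊤, P ((1 / 2 : ℝ) • (w + paritySign p • 𝓜.parityOperator n w)) := by
    intro w
    induction w using homogeneous_induction with
    | h i w hw =>
      rw [parityOperator_of_mem n hw, smul_smul]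
      by_cases hi : (i : ZMod 2) + (n : ZMod 2) = p
      · rw [hi, paritySign_mul_self, one_smul]
        convert h i hi w hw using 1
        module
      · have h2 : ∀ a b : ZMod 2, a ≠ b → b + a = 1 := by decide
        rw [← paritySign_add, h2 _ _ hi, paritySign_one]
        convert h0 using 1
        module
    | hadd w w' hw hw' =>
      convert hadd _ _ hw hw' using 1
      rw [map_add]
      module
  convert key g using 1
  rw [hg, smul_smul, paritySign_mul_self]
  module

end GradedManifold

namespace SymplecticLieAlgebroid

open GradedManifold

variable {𝓜} {n : ℕ} (A : SymplecticLieAlgebroid 𝓜 n)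

open Classical in
/-- The map `{Θ, -}` on `A_{n-1}`, extended by zero to the other degrees. There is no `A_{n-1}` if
`n = 0`. -/
noncomputable def truncatedDifferential : 𝓜.O ⊤ →ₗ[ℝ] 𝓜.O ⊤ :=
  if n = 0 then 0 else A.bracket ⊤ A.Θ ∘ₗ 𝓜.component (n - 1)

lemma truncatedDifferential_of_mem {j : ℕ} {g : 𝓜.O ⊤} (hg : g ∈ 𝓜.gr ⊤ j) :
    A.truncatedDifferential g = if j + 1 = n then A.bracket ⊤ A.Θ g else 0 := by
  rw [truncatedDifferential]
  by_cases hn : n = 0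
  · subst hn
    simp
  · rw [if_neg hn, LinearMap.comp_apply, component_of_mem _ hg]
    by_cases hj : j + 1 = n
    · rw [if_pos hj, if_pos (by omega)]
    · rw [if_neg hj, if_neg (by omega), map_zero]

lemma bracket_Θ_mem {j : ℕ} {g : 𝓜.O ⊤} (hg : g ∈ 𝓜.gr ⊤ j) :
    A.bracket ⊤ A.Θ g ∈ 𝓜.gr ⊤ (j + 1) :=
  A.bracket_mem ⊤ _ _ _ _ _ A.Θ_mem hg (by omega)

lemma truncatedDifferential_mem (g : 𝓜.O ⊤) : A.truncatedDifferential g ∈ 𝓜.gr ⊤ n := by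
  induction g using homogeneous_induction with
  | h i g hg =>
    rw [A.truncatedDifferential_of_mem hg]
    split_ifs with h
    · exact A.bracket_mem ⊤ _ _ _ _ _ A.Θ_mem hg (by omega)
    · exact Submodule.zero_mem _
  | hadd g g' h h' =>
    rw [map_add]
    exact Submodule.add_mem _ h h'

lemma mem_carrier {i : ℕ} (hi : i < n) {g : 𝓜.O ⊤} (hg : g ∈ 𝓜.gr ⊤ i) : g ∈ A.carrier :=
  Submodule.mem_iSup_of_mem i (Submodule.mem_iSup_of_mem hi hg)

@[elab_as_elim]
lemma carrier_induction {P : 𝓜.O ⊤ → Prop} (h : ∀ i < n, ∀ g ∈ 𝓜.gr ⊤ i, P g) (h0 : P 0)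
    (hadd : ∀ g g', P g → P g' → P (g + g')) (g : 𝓜.O ⊤) (hg : g ∈ A.carrier) : P g := by
  rw [carrier] at hg
  refine Submodule.iSup_induction _ (motive := P) hg (fun i g hg => ?_) h0 hadd
  exact Submodule.iSup_induction _ (motive := P) hg (fun hi g hg => h i hi g hg) h0 hadd

lemma neg_one_pow_mul_eq_paritySign (i j : ℕ) :
    (-1 : ℝ) ^ ((i + n) * (j + n)) =
      paritySign (((i : ZMod 2) + (n : ZMod 2)) * ((j : ZMod 2) + (n : ZMod 2))) := by
  rw [neg_one_pow_eq_paritySign]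
  push_cast
  rfl

lemma bracket_Θ_bracket {i : ℕ} {g : 𝓜.O ⊤} (hg : g ∈ 𝓜.gr ⊤ i) (h : 𝓜.O ⊤) :
    A.bracket ⊤ A.Θ (A.bracket ⊤ g h) = A.bracket ⊤ (A.bracket ⊤ A.Θ g) h +
      paritySign ((i : ZMod 2) + (n : ZMod 2)) • A.bracket ⊤ g (A.bracket ⊤ A.Θ h) := by
  rw [A.jacobi ⊤ _ _ _ _ h A.Θ_mem hg, neg_one_pow_mul_eq_paritySign]
  congr 3
  push_cast
  generalize (n : ZMod 2) = a
  generalize (i : ZMod 2) = b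
  revert a b
  decide

lemma bracket_Θ_bracket_Θ (g : 𝓜.O ⊤) : A.bracket ⊤ A.Θ (A.bracket ⊤ A.Θ g) = 0 := by
  have h := A.bracket_Θ_bracket A.Θ_mem g
  have h1 : ((n + 1 : ℕ) : ZMod 2) + (n : ZMod 2) = 1 := by
    push_cast
    generalize (n : ZMod 2) = a
    revert a
    decide
  rw [A.bracket_Θ_Θ, map_zero, LinearMap.zero_apply, zero_add, h1, paritySign_one] at h
  have h2 : (2 : ℝ) • A.bracket ⊤ A.Θ (A.bracket ⊤ A.Θ g) = 0 := by
    rw [two_smul]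
    nth_rewrite 1 [h]
    simp
  exact (smul_eq_zero.1 h2).resolve_left two_ne_zero

lemma truncatedDifferential_bracket_of_mem {j : ℕ} {g h : 𝓜.O ⊤} (hh : h ∈ 𝓜.gr ⊤ j) :
    A.bracket ⊤ (A.truncatedDifferential g) h ∈ 𝓜.gr ⊤ j :=
  A.bracket_mem ⊤ n j j _ _ (A.truncatedDifferential_mem g) hh (by omega)

lemma bracket_Θ_truncatedDifferential (g : 𝓜.O ⊤) :
    A.bracket ⊤ A.Θ (A.truncatedDifferential g) = 0 := by
  rw [truncatedDifferential]
  split_ifs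
  · simp
  · exact A.bracket_Θ_bracket_Θ _

lemma truncatedDifferential_bracket_truncatedDifferential (g h : 𝓜.O ⊤) :
    A.truncatedDifferential (A.bracket ⊤ (A.truncatedDifferential g) h) =
      A.bracket ⊤ (A.truncatedDifferential g) (A.truncatedDifferential h) := by
  induction h using homogeneous_induction with
  | h j h hh =>
    rw [A.truncatedDifferential_of_mem (A.truncatedDifferential_bracket_of_mem hh),
      A.truncatedDifferential_of_mem hh]
    split_ifs with hj
    · have h1 : (n : ZMod 2) + (n : ZMod 2) = 0 := CharTwo.add_self_eq_zero _
      rw [A.bracket_Θ_bracket (A.truncatedDifferential_mem g), bracket_Θ_truncatedDifferential,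
        map_zero, LinearMap.zero_apply, zero_add, h1, paritySign_zero, one_smul]
    · rw [map_zero]
  | hadd h h' hh hh' => simp only [map_add, hh, hh']

/-- The bracket of functions of degrees less than `n` has degree at most `n - 2`. -/
lemma bracket_mem_carrier {g h : 𝓜.O ⊤} (hg : g ∈ A.carrier) (hh : h ∈ A.carrier) :
    A.bracket ⊤ g h ∈ A.carrier ∧ A.truncatedDifferential (A.bracket ⊤ g h) = 0 := by
  refine A.carrier_induction (fun i hi g hg => ?_) ?_ (fun g g' hg hg' => ?_) g hg
  · refine A.carrier_induction (fun j hj h hh => ?_) ?_ (fun h h' hh hh' => ?_) h hh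
    · by_cases hij : i + j < n
      · rw [A.bracket_eq_zero ⊤ i j g h hg hh hij]
        exact ⟨Submodule.zero_mem _, map_zero _⟩
      · have h1 := A.bracket_mem ⊤ i j (i + j - n) g h hg hh (by omega)
        refine ⟨A.mem_carrier (by omega) h1, ?_⟩
        rw [A.truncatedDifferential_of_mem h1, if_neg (by omega)]
    · simp
    · rw [map_add, map_add, hh.2, hh'.2, add_zero]
      exact ⟨Submodule.add_mem _ hh.1 hh'.1, rfl⟩
  · simp
  · rw [map_add, LinearMap.add_apply, map_add, hg.2, hg'.2, add_zero]
    exact ⟨Submodule.add_mem _ hg.1 hg'.1, rfl⟩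

lemma parityOperator_bracket (g h : 𝓜.O ⊤) : 𝓜.parityOperator n (A.bracket ⊤ g h) =
    A.bracket ⊤ (𝓜.parityOperator n g) (𝓜.parityOperator n h) := by
  induction g using homogeneous_induction with
  | h i g hg =>
    induction h using homogeneous_induction with
    | h j h hh =>
      rw [parityOperator_of_mem n hg, parityOperator_of_mem n hh, map_smul, map_smul,
        LinearMap.smul_apply, smul_smul, ← paritySign_add]
      by_cases hij : i + j < n
      · rw [A.bracket_eq_zero ⊤ i j g h hg hh hij, map_zero, smul_zero]
      · obtain ⟨k, hk⟩ := Nat.exists_eq_add_of_le (not_lt.1 hij)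
        rw [parityOperator_of_mem n (A.bracket_mem ⊤ i j k g h hg hh (by omega))]
        congr 2
        have h1 := congrArg (Nat.cast : ℕ → ZMod 2) hk
        push_cast at h1
        have h2 : (n : ZMod 2) + (n : ZMod 2) = 0 := CharTwo.add_self_eq_zero _
        linear_combination -h1 - h2
    | hadd h h' hh hh' => rw [map_add, map_add, hh, hh', map_add, map_add]
  | hadd g g' hg hg' =>
    rw [map_add, LinearMap.add_apply, map_add, hg, hg', map_add, map_add, LinearMap.add_apply]

lemma bracket_antisymm {p q : ZMod 2} {g h : 𝓜.O ⊤}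
    (hg : 𝓜.parityOperator n g = paritySign p • g) (hh : 𝓜.parityOperator n h = paritySign q • h) :
    A.bracket ⊤ g h = -(paritySign (p * q) • A.bracket ⊤ h g) := by
  refine parity_induction (𝓜 := 𝓜) (p := p)
    (P := fun g => A.bracket ⊤ g h = -(paritySign (p * q) • A.bracket ⊤ h g)) n
        (fun i hi g hg => ?_) ?_ (fun g g' hg hg' => ?_) g hg
  · refine parity_induction (𝓜 := 𝓜) (p := q)
      (P := fun h => A.bracket ⊤ g h = -(paritySign (p * q) • A.bracket ⊤ h g)) n
          (fun j hj h hh => ?_) ?_ (fun h h' hh hh' => ?_) h hh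
    · rw [A.antisymm ⊤ i j g h hg hh, neg_one_pow_mul_eq_paritySign, hi, hj]
    · rw [map_zero, map_zero, LinearMap.zero_apply, smul_zero, neg_zero]
    · rw [map_add, map_add, LinearMap.add_apply, hh, hh', smul_add, neg_add]
  · rw [map_zero, map_zero, LinearMap.zero_apply, smul_zero, neg_zero]
  · rw [map_add, map_add, LinearMap.add_apply, hg, hg', smul_add, neg_add]

lemma bracket_jacobi {p q : ZMod 2} {g h : 𝓜.O ⊤} (k : 𝓜.O ⊤)
    (hg : 𝓜.parityOperator n g = paritySign p • g) (hh : 𝓜.parityOperator n h = paritySign q • h) :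
    A.bracket ⊤ g (A.bracket ⊤ h k) = A.bracket ⊤ (A.bracket ⊤ g h) k +
      paritySign (p * q) • A.bracket ⊤ h (A.bracket ⊤ g k) := by
  refine parity_induction (𝓜 := 𝓜) (p := p)
    (P := fun g => A.bracket ⊤ g (A.bracket ⊤ h k) =
      A.bracket ⊤ (A.bracket ⊤ g h) k + paritySign (p * q) • A.bracket ⊤ h (A.bracket ⊤ g k)) n
    (fun i hi g hg => ?_) ?_ (fun g g' hg hg' => ?_) g hg
  · refine parity_induction (𝓜 := 𝓜) (p := q)
      (P := fun h => A.bracket ⊤ g (A.bracket ⊤ h k) =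
        A.bracket ⊤ (A.bracket ⊤ g h) k + paritySign (p * q) • A.bracket ⊤ h (A.bracket ⊤ g k)) n
      (fun j hj h hh => ?_) ?_ (fun h h' hh hh' => ?_) h hh
    · rw [A.jacobi ⊤ i j g h k hg hh, neg_one_pow_mul_eq_paritySign, hi, hj]
    · simp only [map_zero, LinearMap.zero_apply, smul_zero, add_zero]
    · simp only [map_add, LinearMap.add_apply, smul_add]
      rw [hh, hh']
      abel
  · simp only [map_zero, LinearMap.zero_apply, smul_zero, add_zero]
  · simp only [map_add, LinearMap.add_apply, smul_add]
    rw [hg, hg']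
    abel

/-- The differential graded Lie algebra of the global functions, where functions of degree `i` are
placed in degree `i - n`. -/
noncomputable def dgla : TruncatedDGLA (𝓜.O ⊤) where
  br := A.bracket ⊤
  π := 𝓜.parityOperator n
  Q := A.bracket ⊤ A.Θ
  δ := A.truncatedDifferential
  V := A.carrier
  π_π := parityOperator_parityOperator n
  π_br := A.parityOperator_bracket
  antisymm _ _ _ _ hg hh := A.bracket_antisymm hg hh
  jacobi _ _ _ _ k hg hh := A.bracket_jacobi k hg hh
  π_Q g := by
    induction g using homogeneous_induction with
    | h i g hg =>
      rw [parityOperator_of_mem n hg, parityOperator_of_mem n (A.bracket_Θ_mem hg), map_smul,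
        ← neg_smul, neg_paritySign]
      congr 2
      push_cast
      ring
    | hadd g g' hg hg' =>
      simp only [map_add, hg, hg']
      module
  Q_br p g h hg := by
    refine parity_induction (𝓜 := 𝓜) (p := p)
      (P := fun g => A.bracket ⊤ A.Θ (A.bracket ⊤ g h) = A.bracket ⊤ (A.bracket ⊤ A.Θ g) h +
        paritySign p • A.bracket ⊤ g (A.bracket ⊤ A.Θ h)) n
      (fun i hi g hg => ?_) ?_ (fun g g' hg hg' => ?_) g hg
    · rw [A.bracket_Θ_bracket hg, hi]
    · simp only [map_zero, LinearMap.zero_apply, smul_zero, add_zero]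
    · simp only [map_add, LinearMap.add_apply, smul_add]
      rw [hg, hg']
      abel
  Q_Q := A.bracket_Θ_bracket_Θ
  π_δ g := by
    rw [parityOperator_of_mem n (A.truncatedDifferential_mem g), CharTwo.add_self_eq_zero,
      paritySign_zero, one_smul]
  δ_π g := by
    induction g using homogeneous_induction with
    | h i g hg =>
      rw [parityOperator_of_mem n hg, map_smul, A.truncatedDifferential_of_mem hg]
      split_ifs with hi
      · subst hi
        have h1 : (i : ZMod 2) + ((i + 1 : ℕ) : ZMod 2) = 1 := by
          push_cast
          generalize (i : ZMod 2) = x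
          revert x
          decide
        rw [h1, paritySign_one, neg_one_smul]
      · simp
    | hadd g g' hg hg' =>
      simp only [map_add, hg, hg']
      module
  Q_δ := A.bracket_Θ_truncatedDifferential
  δ_Q g := by
    induction g using homogeneous_induction with
    | h i g hg =>
      rw [A.truncatedDifferential_of_mem (A.bracket_Θ_mem hg), A.bracket_Θ_bracket_Θ, ite_self]
    | hadd g g' hg hg' => simp only [map_add, hg, hg', add_zero]
  δ_δ g := by rw [A.truncatedDifferential_of_mem (A.truncatedDifferential_mem g), if_neg (by omega)]
  δ_br_δ := A.truncatedDifferential_bracket_truncatedDifferential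
  π_mem g hg := by
    refine A.carrier_induction (fun i hi g hg => ?_) ?_ (fun g g' hg hg' => ?_) g hg
    · rw [parityOperator_of_mem n hg]
      exact A.mem_carrier hi (Submodule.smul_mem _ _ hg)
    · rw [map_zero]
      exact Submodule.zero_mem _
    · rw [map_add]
      exact Submodule.add_mem _ hg hg'
  br_mem g hg h hh := (A.bracket_mem_carrier hg hh).1
  br_δ_mem g h hh := by
    refine A.carrier_induction (fun i hi h hh => ?_) ?_ (fun h h' hh hh' => ?_) h hh
    · exact A.mem_carrier hi (A.truncatedDifferential_bracket_of_mem hh)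
    · rw [map_zero]
      exact Submodule.zero_mem _
    · rw [map_add]
      exact Submodule.add_mem _ hh hh'
  δ_br g hg h hh := (A.bracket_mem_carrier hg hh).2
  Q_sub_δ_mem g hg := by
    refine A.carrier_induction (fun i hi g hg => ?_) ?_ (fun g g' hg hg' => ?_) g hg
    · rw [A.truncatedDifferential_of_mem hg]
      split_ifs with h
      · rw [sub_self]
        exact Submodule.zero_mem _
      · rw [sub_zero]
        exact A.mem_carrier (by omega) (A.bracket_Θ_mem hg)
    · rw [map_zero, map_zero, sub_zero]
      exact Submodule.zero_mem _
    · rw [map_add, map_add, add_sub_add_comm]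
      exact Submodule.add_mem _ hg hg'

end SymplecticLieAlgebroid

end

/-! ### Signs of the suspension -/

/-- The suspension turns Koszul signs of graded commuting elements into signs of graded
anticommuting elements. -/
lemma pairSum_add_koszulExponent {k : ℕ} (deg : Fin k → ℤ) (σ : Equiv.Perm (Fin k)) :
    pairSum (fun a _ => (deg a : ZMod 2)) +
        koszulExponent (fun i => ((deg i - 1 : ℤ) : ZMod 2)) σ =
      inversionSum (fun _ _ => 1) σ + koszulExponent (fun i => (deg i : ZMod 2)) σ +
        pairSum fun a _ => (deg (σ a) : ZMod 2) := by
  have h1 := pairSum_comp_perm (fun a _ => (deg a : ZMod 2)) σ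
  have h2 : koszulExponent (fun i => ((deg i - 1 : ℤ) : ZMod 2)) σ =
      koszulExponent (fun i => (deg i : ZMod 2)) σ +
        inversionSum (fun a b => (deg a : ZMod 2) + (deg b : ZMod 2)) σ +
        inversionSum (fun _ _ => 1) σ := by
    rw [koszulExponent, koszulExponent, ← inversionSum_add, ← inversionSum_add]
    congr 1
    funext a b
    push_cast
    generalize (deg a : ZMod 2) = x
    generalize (deg b : ZMod 2) = y
    revert x y
    decide
  rw [h1, h2]
  ring

lemma antisymmetricSign_eq {k : ℕ} (deg : Fin k → ℤ) (σ : Equiv.Perm (Fin k)) :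
    antisymmetricSign deg σ = paritySign (pairSum (fun a _ => (deg a : ZMod 2)) +
      koszulExponent (fun i => ((deg i - 1 : ℤ) : ZMod 2)) σ +
        pairSum fun a _ => (deg (σ a) : ZMod 2)) := by
  rw [antisymmetricSign, koszulSign_eq, sign_eq_paritySign, ← paritySign_add,
    pairSum_add_koszulExponent, add_assoc (_ + _), CharTwo.add_self_eq_zero, add_zero]

lemma pairSum_fst {k : ℕ} (f : Fin (k + 1) → ZMod 2) :
    pairSum (fun a _ => f a) = ∑ a : Fin (k + 1), ((k - a.val : ℕ) : ZMod 2) * f a := by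
  refine Finset.sum_congr rfl fun a _ => ?_
  rw [← Finset.sum_filter, Finset.sum_const, nsmul_eq_mul]
  congr 2
  rw [Finset.filter_lt_eq_Ioi, Fin.card_Ioi]
  omega

lemma suspendedKoszulSign_eq {k : ℕ} (deg : Fin (k + 1) → ℤ) (σ : Equiv.Perm (Fin (k + 1))) :
    suspendedKoszulSign deg σ = paritySign (pairSum fun a _ => (deg a : ZMod 2)) *
      paritySign (koszulExponent (fun i => ((deg i - 1 : ℤ) : ZMod 2)) σ) := by
  rw [suspendedKoszulSign, koszulSign_eq, neg_one_zpow_eq_paritySign, pairSum_fst]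
  congr 2
  rw [Int.cast_sum]
  refine Finset.sum_congr rfl fun a _ => ?_
  rw [Int.cast_mul, ← Int.cast_natCast, Nat.cast_sub (by omega)]
  push_cast
  ring

namespace TruncatedDGLA

variable {G : Type*} [AddCommGroup G] [Module ℝ G]

lemma foldl_ofFn_eq_nestedBracket (br : G →ₗ[ℝ] G →ₗ[ℝ] G) (δ : G →ₗ[ℝ] G) (k : ℕ)
    (y : Fin (k + 1) → G) :
    List.foldl (fun a b => br a b) (δ (y 0)) (List.ofFn fun i : Fin k => y i.succ) =
      nestedBracket br δ k y := by
  induction k with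
  | zero => rfl
  | succ k ih =>
    rw [List.ofFn_succ', List.concat_eq_append, List.foldl_append, nestedBracket_succ,
      ← ih fun i => y i.castSucc]
    rfl

end TruncatedDGLA

/-! ### The `L_∞`-algebra of a symplectic Lie `n`-algebroid -/

section

variable {d : ℕ} {M : Type u} [TopologicalSpace M]
  [ChartedSpace (EuclideanSpace ℝ (Fin d)) M] [IsManifold (𝓡 d) ∞ M]

/-- The global functions of degree `z`, where `z` may be negative. -/
noncomputable def GradedManifold.integerGrading (𝓜 : GradedManifold.{u, v} d M) (z : ℤ) :
    Submodule ℝ (𝓜.O ⊤) :=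
  if 0 ≤ z then 𝓜.gr ⊤ z.toNat else ⊥

namespace SymplecticLieAlgebroid

open GradedManifold TruncatedDGLA

variable {𝓜 : GradedManifold.{u, v} d M} {n : ℕ} (A : SymplecticLieAlgebroid 𝓜 n)

lemma mem_integerGrading {z : ℤ} {g : 𝓜.O ⊤} (hg : g ∈ 𝓜.integerGrading z) :
    g = 0 ∨ ∃ j : ℕ, (j : ℤ) = z ∧ g ∈ 𝓜.gr ⊤ j := by
  rw [integerGrading] at hg
  split_ifs at hg with hz
  · exact Or.inr ⟨z.toNat, Int.toNat_of_nonneg hz, hg⟩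
  · exact Or.inl hg

lemma mem_integerGrading_of_mem {z : ℤ} {j : ℕ} (hj : (j : ℤ) = z) {g : 𝓜.O ⊤}
    (hg : g ∈ 𝓜.gr ⊤ j) : g ∈ 𝓜.integerGrading z := by
  subst hj
  rw [integerGrading, if_pos (Int.natCast_nonneg j), Int.toNat_natCast]
  exact hg

/-- The part of degree at least `n` of an element of `A_0 ⊕ ⋯ ⊕ A_{n-1}` vanishes. -/
lemma component_of_mem_carrier {j : ℕ} (hj : n ≤ j) {g : 𝓜.O ⊤} (hg : g ∈ A.carrier) :
    𝓜.component j g = 0 := by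
  refine A.carrier_induction (fun i hi g hg => ?_) (map_zero _) (fun g g' hg hg' => ?_) g hg
  · rw [component_of_mem j hg, if_neg (by omega)]
  · rw [map_add, hg, hg', add_zero]

lemma mem_grading_iff {ℓ : ℤ} {e : A.carrier} :
    e ∈ A.grading ℓ ↔ (e : 𝓜.O ⊤) ∈ 𝓜.integerGrading (ℓ + n - 1) := by
  rw [grading]
  split_ifs with hℓ
  · rw [integerGrading, if_pos (by omega)]
    rfl
  · rw [Submodule.mem_bot]
    constructor
    · rintro rfl
      exact Submodule.zero_mem _
    · intro he
      rcases mem_integerGrading he with h | ⟨j, hj, h⟩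
      · exact Subtype.ext h
      · have h1 := A.component_of_mem_carrier (j := j) (by omega) e.2
        rw [component_of_mem j h, if_pos rfl] at h1
        exact Subtype.ext h1

lemma bracket_mem_integerGrading {y z : ℤ} {g h : 𝓜.O ⊤} (hg : g ∈ 𝓜.integerGrading y)
    (hh : h ∈ 𝓜.integerGrading z) : A.bracket ⊤ g h ∈ 𝓜.integerGrading (y + z - n) := by
  rcases mem_integerGrading hg with rfl | ⟨i, hi, hg⟩
  · rw [map_zero, LinearMap.zero_apply]
    exact Submodule.zero_mem _
  rcases mem_integerGrading hh with rfl | ⟨j, hj, hh⟩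
  · rw [map_zero]
    exact Submodule.zero_mem _
  by_cases hij : i + j < n
  · rw [A.bracket_eq_zero ⊤ i j g h hg hh hij]
    exact Submodule.zero_mem _
  · exact mem_integerGrading_of_mem (j := i + j - n) (by omega)
      (A.bracket_mem ⊤ i j _ g h hg hh (by omega))

lemma bracket_Θ_mem_integerGrading {z : ℤ} {g : 𝓜.O ⊤} (hg : g ∈ 𝓜.integerGrading z) :
    A.bracket ⊤ A.Θ g ∈ 𝓜.integerGrading (z + 1) := by
  rcases mem_integerGrading hg with rfl | ⟨i, hi, hg⟩
  · rw [map_zero]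
    exact Submodule.zero_mem _
  · exact mem_integerGrading_of_mem (j := i + 1) (by omega) (A.bracket_Θ_mem hg)

lemma truncatedDifferential_mem_integerGrading {z : ℤ} {g : 𝓜.O ⊤}
    (hg : g ∈ 𝓜.integerGrading z) : A.truncatedDifferential g ∈ 𝓜.integerGrading (z + 1) := by
  rcases mem_integerGrading hg with rfl | ⟨i, hi, hg'⟩
  · rw [map_zero]
    exact Submodule.zero_mem _
  · rw [A.truncatedDifferential_of_mem hg']
    split_ifs
    · exact A.bracket_Θ_mem_integerGrading hg
    · exact Submodule.zero_mem _

lemma nestedBracket_mem_integerGrading {k : ℕ} {z : Fin (k + 1) → ℤ} {g : Fin (k + 1) → 𝓜.O ⊤}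
    (hg : ∀ i, g i ∈ 𝓜.integerGrading (z i)) :
    nestedBracket A.dgla.br A.dgla.δ k g ∈ 𝓜.integerGrading (∑ i, z i + 1 - k * n) := by
  induction k with
  | zero =>
    rw [nestedBracket_zero]
    convert A.truncatedDifferential_mem_integerGrading (hg 0) using 1
    · simp
    · rfl
  | succ k ih =>
    rw [nestedBracket_succ]
    convert A.bracket_mem_integerGrading (ih fun i => hg i.castSucc) (hg (Fin.last _)) using 1
    · rw [Fin.sum_univ_castSucc]
      push_cast
      congr 1
      ring
    · rfl

lemma isHomog_of_mem_grading {ℓ : ℤ} {e : A.carrier} (he : e ∈ A.grading ℓ) :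
    A.dgla.IsHomog ((ℓ - 1 : ℤ) : ZMod 2) e := by
  rw [mem_grading_iff] at he
  rcases mem_integerGrading he with h | ⟨j, hj, h⟩
  · rw [h]
    exact IsHomog.zero _
  · have h1 := parityOperator_of_mem n h
    have h2 : (j : ZMod 2) + (n : ZMod 2) = ((ℓ - 1 : ℤ) : ZMod 2) := by
      have h3 := congrArg (Int.cast : ℤ → ZMod 2) hj
      have h4 : (n : ZMod 2) + (n : ZMod 2) = 0 := CharTwo.add_self_eq_zero _
      push_cast at h3 ⊢
      linear_combination h3 + h4
    rw [h2] at h1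
    exact h1

lemma koszulBracket_mem_integerGrading {k : ℕ} {deg : Fin (k + 1) → ℤ}
    {x : Fin (k + 1) → A.carrier} (hx : ∀ i, x i ∈ A.grading (deg i)) :
    A.dgla.koszulBracket k (fun i => (x i : 𝓜.O ⊤)) ∈
      𝓜.integerGrading (∑ i, deg i + 2 - (k + 1 : ℕ) + n - 1) := by
  have hx' := fun i => A.mem_grading_iff.1 (hx i)
  have hdeg : ∀ ρ : Equiv.Perm (Fin (k + 1)), ∑ i, (deg (ρ i) + n - 1) + 1 - k * n =
      ∑ i, deg i + 2 - (k + 1 : ℕ) + n - 1 := by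
    intro ρ
    rw [Equiv.sum_comp ρ fun i => deg i + n - 1, Finset.sum_sub_distrib, Finset.sum_add_distrib]
    simp
    ring
  rw [koszulBracket_of_isHomog fun i => A.isHomog_of_mem_grading (hx i)]
  refine Submodule.sub_mem _ ?_ (Submodule.smul_mem _ _
    (Submodule.sum_mem _ fun ρ _ => Submodule.smul_mem _ _ ?_))
  · cases k with
    | zero =>
      rw [linearPart_zero]
      convert A.bracket_Θ_mem_integerGrading (hx' 0) using 1
      · rw [← hdeg 1]
        simp
      · rfl
    | succ k => exact Submodule.zero_mem _
  · rw [← hdeg ρ]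
    exact A.nestedBracket_mem_integerGrading fun i => hx' (ρ i)

/-- The operator `(-1) ^ ℓ` on elements of degree `ℓ`, extended to all functions. -/
noncomputable def degreeSign : Module.End ℝ (𝓜.O ⊤) := -A.dgla.π

lemma degreeSign_pow_mem (k : ℕ) {g : 𝓜.O ⊤} (hg : g ∈ A.carrier) :
    (A.degreeSign ^ k) g ∈ A.carrier := by
  induction k with
  | zero => exact hg
  | succ k ih =>
    rw [pow_succ', Module.End.mul_apply]
    exact Submodule.neg_mem _ (A.dgla.π_mem _ ih)

lemma degreeSign_pow_of_mem_grading (k : ℕ) {ℓ : ℤ} {e : A.carrier} (he : e ∈ A.grading ℓ) :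
    (A.degreeSign ^ k) (e : 𝓜.O ⊤) = paritySign ((k : ZMod 2) * (ℓ : ZMod 2)) • (e : 𝓜.O ⊤) := by
  have h : A.degreeSign (e : 𝓜.O ⊤) = paritySign (ℓ : ZMod 2) • (e : 𝓜.O ⊤) := by
    have h1 := A.isHomog_of_mem_grading he
    rw [IsHomog] at h1
    rw [degreeSign, LinearMap.neg_apply, h1, ← neg_smul, neg_paritySign]
    congr 2
    push_cast
    ring
  induction k with
  | zero => simp
  | succ k ih =>
    rw [pow_succ', Module.End.mul_apply, ih, map_smul, h, smul_smul, ← paritySign_add]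
    congr 2
    push_cast
    ring

/-- The products of the `L_∞`-algebra: the brackets `koszulBracket` transported along the
suspension, that is, multiplied by `(-1) ^ ∑ i, (k - i) |e_i|`. -/
noncomputable def product :
    ∀ k : ℕ, MultilinearMap ℝ (fun _ : Fin k => A.carrier) A.carrier
  | 0 => 0
  | k + 1 => ((A.dgla.koszulBracket k).compLinearMap fun i : Fin (k + 1) =>
      (A.degreeSign ^ (k - i.val)) ∘ₗ A.carrier.subtype).codRestrict A.carrier fun x =>
        koszulBracket_mem (A := A.dgla) k
          (g := fun i => (A.degreeSign ^ (k - i.val)) (x i : 𝓜.O ⊤))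
          fun i => A.degreeSign_pow_mem _ (x i).2

lemma product_apply {k : ℕ} {deg : Fin (k + 1) → ℤ} {x : Fin (k + 1) → A.carrier}
    (hx : ∀ i, x i ∈ A.grading (deg i)) :
    (A.product (k + 1) x : 𝓜.O ⊤) = paritySign (pairSum fun a _ => (deg a : ZMod 2)) •
      A.dgla.koszulBracket k fun i => (x i : 𝓜.O ⊤) := by
  change A.dgla.koszulBracket k (fun i => (A.degreeSign ^ (k - i.val)) (x i : 𝓜.O ⊤)) = _
  rw [funext fun i => A.degreeSign_pow_of_mem_grading (k - i.val) (hx i),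
    MultilinearMap.map_smul_univ, ← paritySign_sum, pairSum_fst]

lemma product_mem_grading (k : ℕ) {deg : Fin k → ℤ} {x : Fin k → A.carrier}
    (hx : ∀ i, x i ∈ A.grading (deg i)) : A.product k x ∈ A.grading (∑ i, deg i + 2 - k) := by
  cases k with
  | zero => exact Submodule.zero_mem (A.grading _)
  | succ k =>
    rw [mem_grading_iff, A.product_apply hx]
    exact Submodule.smul_mem _ _ (A.koszulBracket_mem_integerGrading hx)

lemma product_antisymm (k : ℕ) {deg : Fin k → ℤ} {x : Fin k → A.carrier}
    (hx : ∀ i, x i ∈ A.grading (deg i)) (σ : Equiv.Perm (Fin k)) :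
    A.product k x = antisymmetricSign deg σ • A.product k (x ∘ σ) := by
  cases k with
  | zero => simp [product]
  | succ k =>
    refine Subtype.ext ?_
    rw [Submodule.coe_smul, A.product_apply hx, A.product_apply (x := x ∘ σ) fun i => hx (σ i),
      koszulBracket_comp_perm (fun i => A.isHomog_of_mem_grading (hx i)) σ, antisymmetricSign_eq,
      smul_smul, smul_smul, ← paritySign_add, ← paritySign_add, add_assoc (_ + _),
      CharTwo.add_self_eq_zero, add_zero]
    rfl

/-- Up to a sign that does not depend on the unshuffle, the terms of the Jacobi identity are those
of the Jacobi identity for `koszulBracket`. -/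
lemma product_cons_product {m : ℕ} {deg : Fin m → ℤ} {x : Fin m → A.carrier}
    (hx : ∀ i, x i ∈ A.grading (deg i)) (p : Fin m) (σ : Equiv.Perm (Fin m)) :
    ((((-1 : ℝ) ^ ((p.val + 1) * (m - (p.val + 1))) * antisymmetricSign deg σ) •
      A.product (m - (p.val + 1) + 1)
        (Fin.cons (A.product (p.val + 1) fun a : Fin (p.val + 1) => x (σ ⟨a.val, by omega⟩))
          fun b : Fin (m - (p.val + 1)) => x (σ ⟨p.val + 1 + b.val, by omega⟩)) : A.carrier) :
            𝓜.O ⊤) =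
      paritySign (pairSum fun a _ => (deg a : ZMod 2)) •
        paritySign (koszulExponent (fun i => ((deg i - 1 : ℤ) : ZMod 2)) σ) •
          A.dgla.koszulBracket (m - (p.val + 1))
            (Fin.cons (A.dgla.koszulBracket p.val fun a : Fin (p.val + 1) =>
                (x (σ ⟨a.val, by omega⟩) : 𝓜.O ⊤))
              fun b : Fin (m - (p.val + 1)) => (x (σ ⟨p.val + 1 + b.val, by omega⟩) : 𝓜.O ⊤)) := by
  have hp : p.val + 1 ≤ m := p.2
  have hin : ∀ a : Fin (p.val + 1), x (σ ⟨a.val, by omega⟩) ∈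
      A.grading (deg (σ ⟨a.val, by omega⟩)) := fun a => hx _
  have hy := A.product_mem_grading (p.val + 1) hin
  set D : ℤ := ∑ a : Fin (p.val + 1), deg (σ ⟨a.val, by omega⟩) + 2 - (p.val + 1 : ℕ) with hD
  have hout : ∀ i : Fin (m - (p.val + 1) + 1),
      (Fin.cons (A.product (p.val + 1) fun a : Fin (p.val + 1) => x (σ ⟨a.val, by omega⟩))
        (fun b : Fin (m - (p.val + 1)) => x (σ ⟨p.val + 1 + b.val, by omega⟩)) :
          Fin (m - (p.val + 1) + 1) → A.carrier) i ∈
      A.grading ((Fin.cons D fun b : Fin (m - (p.val + 1)) =>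
        deg (σ ⟨p.val + 1 + b.val, by omega⟩) : Fin (m - (p.val + 1) + 1) → ℤ) i) := by
    intro i
    refine Fin.cases ?_ (fun b => ?_) i
    · exact hy
    · exact hx _
  have hcons : (fun i => ((Fin.cons
      (A.product (p.val + 1) fun a : Fin (p.val + 1) => x (σ ⟨a.val, by omega⟩))
        (fun b : Fin (m - (p.val + 1)) => x (σ ⟨p.val + 1 + b.val, by omega⟩)) :
          Fin (m - (p.val + 1) + 1) → A.carrier) i : 𝓜.O ⊤)) =
      Fin.cons (paritySign (pairSum fun a _ : Fin (p.val + 1) =>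
          (deg (σ ⟨a.val, by omega⟩) : ZMod 2)) •
        A.dgla.koszulBracket p.val fun a : Fin (p.val + 1) => (x (σ ⟨a.val, by omega⟩) : 𝓜.O ⊤))
        fun b : Fin (m - (p.val + 1)) => (x (σ ⟨p.val + 1 + b.val, by omega⟩) : 𝓜.O ⊤) := by
    funext i
    refine Fin.cases ?_ (fun b => ?_) i
    · exact A.product_apply hin
    · rfl
  rw [Submodule.coe_smul, A.product_apply hout, hcons, MultilinearMap.cons_smul, smul_smul,
    smul_smul, smul_smul, neg_one_pow_eq_paritySign, antisymmetricSign_eq, ← paritySign_add,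
    ← paritySign_add, ← paritySign_add, ← paritySign_add]
  congr 2
  rw [pairSum_cons]
  simp only [Fin.cons_zero, Fin.cons_succ]
  have h1 := pairSum_split hp fun a _ => (deg (σ a) : ZMod 2)
  simp only [Finset.sum_const, Finset.card_univ, Fintype.card_fin, nsmul_eq_mul] at h1 ⊢
  rw [← Finset.mul_sum] at h1
  have h2 : (D : ZMod 2) = ∑ a : Fin (p.val + 1), (deg (σ ⟨a.val, by omega⟩) : ZMod 2) -
      ((p.val + 1 : ℕ) : ZMod 2) := by
    rw [hD]
    push_cast
    have : (2 : ZMod 2) = 0 := rfl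
    rw [this, add_zero]
  rw [h1, h2, Nat.cast_mul]
  generalize ((m - (p.val + 1) : ℕ) : ZMod 2) = l
  generalize ((p.val + 1 : ℕ) : ZMod 2) = p'
  -- The sum `S` of the inner degrees enters through the degree of the inner product and through
  -- the sign of moving the suspension past the inner arguments.
  have key : ∀ l p' S a b c e : ZMod 2,
      p' * l + (a + b + (c + l * S + e)) + (l * (S - p') + e) + c = a + b := by decide
  exact key _ _ _ _ _ _ _

open Classical in
lemma product_jacobi {m : ℕ} {deg : Fin m → ℤ} {x : Fin m → A.carrier}
    (hx : ∀ i, x i ∈ A.grading (deg i)) :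
    ∑ p : Fin m, ∑ σ : Equiv.Perm (Fin m), (if IsUnshuffle (p.val + 1) σ then
      ((-1 : ℝ) ^ ((p.val + 1) * (m - (p.val + 1))) * antisymmetricSign deg σ) •
        A.product (m - (p.val + 1) + 1)
          (Fin.cons (A.product (p.val + 1) fun a : Fin (p.val + 1) => x (σ ⟨a.val, by omega⟩))
            fun b : Fin (m - (p.val + 1)) => x (σ ⟨p.val + 1 + b.val, by omega⟩))
      else 0) = 0 := by
  refine Subtype.ext ?_
  rw [Submodule.coe_sum, Submodule.coe_zero]
  have h := sum_koszulBracket (A := A.dgla) (fun i => A.isHomog_of_mem_grading (hx i))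
    fun i => (x i).2
  have h2 := congrArg (fun g => paritySign (pairSum fun a _ => (deg a : ZMod 2)) • g) h
  simp only [smul_zero] at h2
  rw [← h2, Finset.smul_sum]
  refine Finset.sum_congr rfl fun p _ => ?_
  rw [Submodule.coe_sum, Finset.smul_sum]
  refine Finset.sum_congr rfl fun σ _ => ?_
  split_ifs
  · exact A.product_cons_product hx p σ
  · rw [smul_zero, Submodule.coe_zero]

lemma isInternal_grading : DirectSum.IsInternal A.grading := by
  rw [DirectSum.isInternal_submodule_iff_iSupIndep_and_iSup_eq_top]
  constructor
  · intro ℓ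
    rw [Submodule.disjoint_def]
    intro e he he'
    rcases mem_integerGrading (A.mem_grading_iff.1 he) with h | ⟨j, hj, h⟩
    · exact Subtype.ext h
    · have h1 : ⨆ (ℓ' : ℤ) (_ : ℓ' ≠ ℓ), A.grading ℓ' ≤
          LinearMap.ker (𝓜.component j ∘ₗ A.carrier.subtype) := by
        refine iSup₂_le fun ℓ' hℓ' e' he' => ?_
        rw [LinearMap.mem_ker, LinearMap.comp_apply, Submodule.subtype_apply]
        rcases mem_integerGrading (A.mem_grading_iff.1 he') with h' | ⟨j', hj', h'⟩
        · rw [h', map_zero]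
        · rw [component_of_mem j h', if_neg]
          rintro rfl
          omega
      have h2 := h1 he'
      rw [LinearMap.mem_ker, LinearMap.comp_apply, Submodule.subtype_apply, component_of_mem j h,
        if_pos rfl] at h2
      exact Subtype.ext h2
  · rw [eq_top_iff]
    intro e _
    have h : ∃ e' : A.carrier, (e' : 𝓜.O ⊤) = e ∧ e' ∈ ⨆ ℓ, A.grading ℓ := by
      refine A.carrier_induction (P := fun g => ∃ e' : A.carrier, (e' : 𝓜.O ⊤) = g ∧
        e' ∈ ⨆ ℓ, A.grading ℓ) (fun i hi g hg => ?_) ⟨0, rfl, Submodule.zero_mem _⟩ ?_ e e.2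
      · refine ⟨⟨g, A.mem_carrier hi hg⟩, rfl, Submodule.mem_iSup_of_mem (i + 1 - n : ℤ) ?_⟩
        rw [mem_grading_iff]
        exact mem_integerGrading_of_mem (by omega) hg
      · rintro _ _ ⟨e₁, rfl, h₁⟩ ⟨e₂, rfl, h₂⟩
        exact ⟨e₁ + e₂, rfl, Submodule.add_mem _ h₁ h₂⟩
    obtain ⟨e', h1, h2⟩ := h
    rwa [← Subtype.ext h1]

lemma isLInfinity_product : IsLInfinity A.grading A.product where
  isInternal := A.isInternal_grading
  zero := rfl
  degree k _ _ hx := A.product_mem_grading k hx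
  antisymm k _ _ hx σ := A.product_antisymm k hx σ
  jacobi _ _ _ hx := A.product_jacobi hx

lemma isNTerm_grading : IsNTerm n A.grading := by
  intro ℓ hℓ
  by_contra h
  exact hℓ (if_neg h)

lemma delta_eq_truncatedDifferential {ℓ : ℤ} {e : A.carrier} (he : e ∈ A.grading ℓ) :
    A.delta e = A.truncatedDifferential e := by
  rw [delta]
  rcases mem_integerGrading (A.mem_grading_iff.1 he) with h | ⟨j, hj, h⟩
  · rw [h, map_zero, map_zero, ite_self]
  -- If `n = 0`, then `A_0 ⊕ ⋯ ⊕ A_{n-1} = 0`, although `n - 1 = 0` is a degree of functions.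
  by_cases hn : n = 0
  · have h1 := A.component_of_mem_carrier (j := j) (by omega) e.2
    rw [component_of_mem j h, if_pos rfl] at h1
    rw [h1, map_zero, map_zero, ite_self]
  split_ifs with h1
  · rw [A.truncatedDifferential_of_mem h1, if_pos (by omega)]
  · rw [A.truncatedDifferential_of_mem h, if_neg]
    rintro rfl
    exact h1 h

open Classical in
lemma product_one {ℓ : ℤ} {e : A.carrier} (he : e ∈ A.grading ℓ) :
    (A.product 1 (fun _ => e) : 𝓜.O ⊤) =
      if (e : 𝓜.O ⊤) ∈ 𝓜.gr ⊤ (n - 1) then 0 else A.bracket ⊤ A.Θ e := by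
  have h1 : A.dgla.koszulBracket 0 (fun _ => (e : 𝓜.O ⊤)) = A.bracket ⊤ A.Θ e - A.delta e := by
    rw [koszulBracket_zero, A.delta_eq_truncatedDifferential he]
    rfl
  rw [A.product_apply (k := 0) (deg := fun _ => ℓ) fun _ => he, h1, delta]
  have h2 : pairSum (fun _ _ : Fin (0 + 1) => (ℓ : ZMod 2)) = 0 := by simp [pairSum]
  rw [h2, paritySign_zero, one_smul]
  split_ifs
  · exact sub_self _
  · exact sub_zero _

lemma product_add_two {k : ℕ} {deg : Fin (k + 2) → ℤ} {e : Fin (k + 2) → A.carrier}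
    (he : ∀ i, e i ∈ A.grading (deg i)) :
    (A.product (k + 2) e : 𝓜.O ⊤) = (-bernoulliCoeff (k + 1)) •
      ∑ σ : Equiv.Perm (Fin (k + 2)), suspendedKoszulSign deg σ •
        A.derivedBracket (List.ofFn fun i => (e (σ i) : 𝓜.O ⊤)) := by
  have h : ∀ σ : Equiv.Perm (Fin (k + 2)), A.derivedBracket
      (List.ofFn fun i => (e (σ i) : 𝓜.O ⊤)) =
      nestedBracket A.dgla.br A.dgla.δ (k + 1) ((fun i => (e i : 𝓜.O ⊤)) ∘ σ) := by
    intro σ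
    rw [List.ofFn_succ, derivedBracket, A.delta_eq_truncatedDifferential (he (σ 0))]
    exact foldl_ofFn_eq_nestedBracket _ _ (k + 1) fun i => (e (σ i) : 𝓜.O ⊤)
  rw [A.product_apply he, koszulBracket_of_isHomog fun i => A.isHomog_of_mem_grading (he i),
    linearPart_succ, zero_sub, neg_smul, smul_neg, smul_comm, Finset.smul_sum]
  congr 2
  refine Finset.sum_congr rfl fun σ _ => ?_
  rw [h, suspendedKoszulSign_eq, smul_smul]

end SymplecticLieAlgebroid

end

open Classical in
theorem mainTheorem2 {d n : ℕ} {M : Type u} [TopologicalSpace M]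
    [ChartedSpace (EuclideanSpace ℝ (Fin d)) M] [IsManifold (𝓡 d) ∞ M]
    [T2Space M] [SecondCountableTopology M]
    (𝓜 : GradedManifold.{u, v} d M) (A : SymplecticLieAlgebroid 𝓜 n) :
    ∃ μ : ∀ k : ℕ, MultilinearMap ℝ (fun _ : Fin k => A.carrier) A.carrier,
      IsLInfinity A.grading μ ∧ IsNTerm n A.grading ∧
      (∀ (ℓ : ℤ) (e : A.carrier), e ∈ A.grading ℓ →
        (μ 1 (fun _ => e) : 𝓜.O ⊤) =
          if (e : 𝓜.O ⊤) ∈ 𝓜.gr ⊤ (n - 1) then 0 else A.bracket ⊤ A.Θ e) ∧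
      ∀ (k : ℕ), 2 ≤ k → ∀ (deg : Fin k → ℤ) (e : Fin k → A.carrier),
        (∀ i, e i ∈ A.grading (deg i)) →
        (μ k e : 𝓜.O ⊤) =
          (-((bernoulli (k - 1) : ℚ) : ℝ) / ((k - 1).factorial : ℝ)) •
            ∑ σ : Equiv.Perm (Fin k), suspendedKoszulSign deg σ •
              A.derivedBracket (List.ofFn fun i => (e (σ i) : 𝓜.O ⊤)) := by
  refine ⟨A.product, A.isLInfinity_product, A.isNTerm_grading, fun ℓ e he => A.product_one he, ?_⟩
  intro k hk deg e he
  obtain ⟨k, rfl⟩ := Nat.exists_eq_add_of_le' hk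
  rw [A.product_add_two he, bernoulliCoeff, neg_div]
  rfl
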